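/- Let $\mathcal X_1,\mathcal X_2,\mathcal X_3$ and $\mathcal Y_1,\mathcal Y_2,\mathcal Y_3$ be non-empty standard Borel alphabets, and let $W=P_{Y_1,Y_2,Y_3|X_1,X_2,X_3}$ be the transition probability of a memoryless three-user interference channel: source $k$ sends an independent message of rate $R_k\ge 0$ to destination $k$, which observes only $Y_k^n$. The capacity region is the convex closure of the set of rate triples $(R_1,R_2,R_3)$ for which there are codes of block length $n$ with at least $e^{nR_k}$ messages for user $k$ and with error probability tending to $0$ as $n\to\infty$. Rates and mutual informations are measured in nats. For an input distribution $P=P_Q\,P_{X_1|Q}P_{X_2|Q}P_{X_3|Q}$ with time-sharing variable $Q$, a channel $V$ with the same alphabets, and a permutation $(a,b,c)$ of $(1,2,3)$, put $$B_{a,b,c}(P,V)=I(Y_a;X_1,X_2,X_3,Q)+I(Y_b;X_b,X_c\mid X_a,Y_a,Q)+I(Y_c;X_c\mid X_a,Y_a,X_b,Y_b,Q),$$ where $(Q,X_1,X_2,X_3)\sim P$ and, given the inputs, $(Y_1,Y_2,Y_3)$ has law $V(\cdot\mid X_1,X_2,X_3)$ and is independent of $Q$. Let $\mathcal S(W)$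 be the set of all channels $V$ with the same conditional marginals as $W$, i.e. $V_{Y_k|X_1,X_2,X_3}=W_{Y_k|X_1,X_2,X_3}$ for $k=1,2,3$. Let $(R_1,R_2,R_3)$ belong to the capacity region of $W$. Then: (i) For every $\varepsilon>0$ there is an input distribution $P$ of the above form, with $Q$ taking finitely many values, such that $R_1+R_2+R_3\le B_{a,b,c}(P,V)+\varepsilon$ for all six permutations $(a,b,c)$ and all $V\in\mathcal S(W)$. That is, $R_1+R_2+R_3\le\sup_P\min_{(a,b,c)}\inf_{V\in\mathcal S(W)}B_{a,b,c}(P,V)$. (ii) If all alphabets are finite, there is an input distribution $P$ of the above form, with $Q$ taking values in a standard Borel space, such that $R_1+R_2+R_3\le B_{a,b,c}(P,V)$ for all six permutations $(a,b,c)$ and all $V\in\mathcal S(W)$. -/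

import Mathlib

open MeasureTheory ProbabilityTheory Filter Topology
open scoped ENNReal

namespace IFC

/-! ### Information measures (in nats, values in `[0, ∞]`) -/

section Information

variable {Ω A B C : Type*} [MeasurableSpace Ω] [MeasurableSpace A] [MeasurableSpace B]
  [MeasurableSpace C]

/-- Mutual information `I(U; V) = D(P_{U,V} ‖ P_U × P_V)`, natural logarithm. -/
noncomputable def mutualInfo (μ : Measure Ω) (U : Ω → A) (V : Ω → B) : ℝ≥0∞ :=
  InformationTheory.klDiv (μ.map fun ω => (U ω, V ω)) ((μ.map U).prod (μ.map V))

/-- Conditional mutual information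
`I(U; V | T) = D(P_{T,U,V} ‖ P_T × P_{U|T} × P_{V|T})`, natural logarithm; `P_{U|T}` and `P_{V|T}`
are regular conditional distributions. -/
noncomputable def condMutualInfo [StandardBorelSpace A] [Nonempty A] [StandardBorelSpace B]
    [Nonempty B] (μ : Measure Ω) [IsFiniteMeasure μ] (U : Ω → A) (V : Ω → B) (T : Ω → C) :
    ℝ≥0∞ :=
  InformationTheory.klDiv (μ.map fun ω => (T ω, U ω, V ω))
    ((μ.map T) ⊗ₘ (condDistrib U T μ ×ₖ condDistrib V T μ))

end Information

section Channel

variable {X Y : Fin 3 → Type*} [∀ k, MeasurableSpace (X k)] [∀ k, MeasurableSpace (Y k)]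

/-! ### Codes, achievable rates, capacity region

A memoryless three-user interference channel is a Markov kernel `W` from `∀ k, X k` to `∀ k, Y k`,
i.e. the transition probability `P_{Y₁,Y₂,Y₃|X₁,X₂,X₃}`; users are numbered `0, 1, 2`. -/

variable (X Y) in
/-- A code of block length `n`: source `k` has `numMsg k` messages, which it encodes into codewords
of length `n`; destination `k` estimates the message of source `k` from its own output block. -/
structure Code (n : ℕ) where
  numMsg : Fin 3 → ℕ
  numMsg_pos : ∀ k, 0 < numMsg k
  enc : ∀ k, Fin (numMsg k) → Fin n → X k
  dec : ∀ k, (Fin n → Y k) → Fin (numMsg k)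
  measurable_dec : ∀ k, Measurable (dec k)

/-- The law of the output block when the messages `w` are sent: the channel acts independently on
the `n` input letters. -/
noncomputable def Code.outputLaw {n : ℕ} (c : Code X Y n) (W : Kernel (∀ k, X k) (∀ k, Y k))
    (w : ∀ k, Fin (c.numMsg k)) : Measure (Fin n → ∀ k, Y k) :=
  Measure.pi fun i => W fun k => c.enc k (w k) i

/-- Probability that some destination decodes its message incorrectly, for independent, uniformly
distributed messages. -/
noncomputable def Code.errorProb {n : ℕ} (c : Code X Y n) (W : Kernel (∀ k, X k) (∀ k, Y k)) :
    ℝ≥0∞ :=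
  (∑ w : ∀ k, Fin (c.numMsg k),
    c.outputLaw W w {y | ∃ k, c.dec k (fun i => y i k) ≠ w k}) / ∏ k, (c.numMsg k : ℝ≥0∞)

/-- The rate triple `R` (in nats per channel use) is achievable: there are codes of block length
`n = 0, 1, 2, …` with at least `exp (n R_k)` messages for user `k` and vanishing error
probability. -/
def Achievable (W : Kernel (∀ k, X k) (∀ k, Y k)) (R : Fin 3 → ℝ) : Prop :=
  (∀ k, 0 ≤ R k) ∧ ∃ c : ∀ n, Code X Y n,
    (∀ (n : ℕ) (k : Fin 3), Real.exp ((n : ℝ) * R k) ≤ ((c n).numMsg k : ℝ)) ∧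
    Tendsto (fun n => (c n).errorProb W) atTop (𝓝 0)

/-- The capacity region: the convex closure of the set of achievable rate triples. -/
def capacityRegion (W : Kernel (∀ k, X k) (∀ k, Y k)) : Set (Fin 3 → ℝ) :=
  closure (convexHull ℝ {R | Achievable W R})

/-- Two channels have the same conditional marginals `P_{Y_k|X₁,X₂,X₃}`, `k = 1, 2, 3`. -/
def SameMarginals (W V : Kernel (∀ k, X k) (∀ k, Y k)) : Prop :=
  ∀ k x, (V x).map (fun y => y k) = (W x).map (fun y => y k)

/-! ### Input distributions with time sharing -/

variable (X) in
/-- An input distribution `P_Q P_{X₁|Q} P_{X₂|Q} P_{X₃|Q}` with time-sharing variable `Q` in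
`𝒬`. -/
structure InputDist (𝒬 : Type*) [MeasurableSpace 𝒬] where
  lawQ : Measure 𝒬
  isProb : IsProbabilityMeasure lawQ
  inp : ∀ k, Kernel 𝒬 (X k)
  isMarkov : ∀ k, IsMarkovKernel (inp k)

attribute [instance] InputDist.isProb InputDist.isMarkov

variable {𝒬 : Type*} [MeasurableSpace 𝒬]

theorem InputDist.measurable_pi (P : InputDist X 𝒬) :
    Measurable fun q => Measure.pi fun k => P.inp k q := by
  refine Measurable.measure_of_isPiSystem_of_isProbabilityMeasure generateFrom_pi.symm
    isPiSystem_pi ?_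
  rintro _ ⟨s, hs, rfl⟩
  simp only [Measure.pi_pi]
  exact Finset.measurable_prod _ fun k _ => (P.inp k).measurable_coe (hs k (Set.mem_univ k))

/-- The conditional law `P_{X₁,X₂,X₃|Q} = P_{X₁|Q} P_{X₂|Q} P_{X₃|Q}`. -/
noncomputable def InputDist.kernel (P : InputDist X 𝒬) : Kernel 𝒬 (∀ k, X k) where
  toFun q := Measure.pi fun k => P.inp k q
  measurable' := P.measurable_pi

instance (P : InputDist X 𝒬) : IsMarkovKernel P.kernel :=
  ⟨fun q => inferInstanceAs (IsProbabilityMeasure (Measure.pi fun k => P.inp k q))⟩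

/-- The law of `(Q, (X₁, X₂, X₃), (Y₁, Y₂, Y₃))`: given the inputs, the outputs follow the channel
`W` and are independent of `Q`. -/
noncomputable def InputDist.jointLaw (P : InputDist X 𝒬) (W : Kernel (∀ k, X k) (∀ k, Y k)) :
    Measure (𝒬 × (∀ k, X k) × (∀ k, Y k)) :=
  P.lawQ ⊗ₘ (P.kernel ⊗ₖ W.prodMkLeft 𝒬)

instance (P : InputDist X 𝒬) (W : Kernel (∀ k, X k) (∀ k, Y k)) [IsMarkovKernel W] :
    IsProbabilityMeasure (P.jointLaw W) :=
  inferInstanceAs (IsProbabilityMeasure (P.lawQ ⊗ₘ (P.kernel ⊗ₖ W.prodMkLeft 𝒬)))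

/-- With the users in the order `a = σ 0`, `b = σ 1`, `c = σ 2`, the quantity
`I(Y_a; X₁,X₂,X₃,Q) + I(Y_b; X_b,X_c | X_a,Y_a,Q) + I(Y_c; X_c | X_a,Y_a,X_b,Y_b,Q)`. -/
noncomputable def sumRateBound [∀ k, StandardBorelSpace (X k)] [∀ k, Nonempty (X k)]
    [∀ k, StandardBorelSpace (Y k)] [∀ k, Nonempty (Y k)]
    (P : InputDist X 𝒬) (W : Kernel (∀ k, X k) (∀ k, Y k)) [IsMarkovKernel W]
    (σ : Equiv.Perm (Fin 3)) : ℝ≥0∞ :=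
  mutualInfo (P.jointLaw W) (fun (_, _, y) => y (σ 0)) (fun (q, x, _) => (x, q)) +
  condMutualInfo (P.jointLaw W) (fun (_, _, y) => y (σ 1)) (fun (_, x, _) => (x (σ 1), x (σ 2)))
    (fun (q, x, y) => (x (σ 0), y (σ 0), q)) +
  condMutualInfo (P.jointLaw W) (fun (_, _, y) => y (σ 2)) (fun (_, x, _) => x (σ 2))
    (fun (q, x, y) => (x (σ 0), y (σ 0), x (σ 1), y (σ 1), q))

end Channel

end IFC

/-! Call a channel causal for the order a, b, c if Y_a ignores the inputs, (Y_a, Y_b) depends only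
on X_a, and the whole output only on (X_a, X_b). When the letters pass through causal channels
independently, the correct-decoding probabilities of all N message triples add up to at most 1, so
decoding is no better than guessing (`sum_causal_correct_le_one`). Comparing a channel V with such
channels through a Fenchel inequality (`mul_measure_le_klDiv_add`) bounds log N, up to error terms,
by the sum over letters of the averaged divergences (`Code.converse`). Passing from W to a channel V
with the same marginals at most triples the error probability (`SameMarginals.errorProb_le`), so one
code, and hence one input distribution, serves every V and every order.

The quantity carried along is the average over Q of `causalDiv`. It is affine in the law of Q, so
the bound survives time sharing, and the slack ε absorbs the closure. To reach the mutual
informations, one particular causal channel is tested: it draws Y_a from its law, then Y_b from its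
conditional law given (X_a, Y_a, Q), then Y_c given (X_a, Y_a, X_b, Y_b, Q). The chain rule splits
the divergence from it into three terms, each at most one of the three informations
(`lintegral_causalDiv_le_sumRateBound`).

For finite alphabets `causalDiv` is an infimum of continuous functions of the input probability
vectors. Its integral is therefore upper semicontinuous under weak convergence of laws on a compact
product of simplices, and a weak limit of near-optimal laws removes ε
(`CausalBound.exists_inputDist_of_finite`). -/

namespace IFC

open InformationTheory
open scoped NNReal

/-! ### Divergence: tensorization, a change-of-measure inequality, conditional divergence. -/

section KLDivergence

variable {α β : Type*} [MeasurableSpace α] [MeasurableSpace β]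

theorem klDiv_map_measurableEquiv (e : α ≃ᵐ β) (μ ν : Measure α) [IsFiniteMeasure μ]
    [IsFiniteMeasure ν] : klDiv (μ.map e) (ν.map e) = klDiv μ ν := by
  refine le_antisymm (klDiv_map_le μ ν e.measurable) ?_
  have h := klDiv_map_le (μ.map e) (ν.map e) e.symm.measurable
  rwa [Measure.map_map e.symm.measurable e.measurable, Measure.map_map e.symm.measurable
    e.measurable, e.symm_comp_self, Measure.map_id, Measure.map_id] at h

theorem klDiv_prod (μ μ' : Measure α) (ν ν' : Measure β) [IsProbabilityMeasure μ]
    [IsProbabilityMeasure μ'] [IsProbabilityMeasure ν] [IsProbabilityMeasure ν'] :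
    klDiv (μ.prod ν) (μ'.prod ν') = klDiv μ μ' + klDiv ν ν' := by
  rw [← Measure.compProd_const, ← Measure.compProd_const, klDiv_compProd_eq_add]
  congr 1
  rw [Measure.compProd_const, Measure.compProd_const,
    ← klDiv_map_measurableEquiv MeasurableEquiv.prodComm (μ.prod ν)]
  simp only [MeasurableEquiv.prodComm, MeasurableEquiv.coe_mk, Equiv.coe_prodComm]
  rw [Measure.prod_swap, Measure.prod_swap, ← Measure.compProd_const, ← Measure.compProd_const,
    klDiv_compProd_left]

theorem klDiv_pi {n : ℕ} (μ ν : Fin n → Measure α) [∀ i, IsProbabilityMeasure (μ i)]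
    [∀ i, IsProbabilityMeasure (ν i)] :
    klDiv (Measure.pi μ) (Measure.pi ν) = ∑ i, klDiv (μ i) (ν i) := by
  induction n with
  | zero =>
    rw [Measure.pi_of_empty μ, Measure.pi_of_empty ν, klDiv_self]
    simp
  | succ n ih =>
    rw [← klDiv_map_measurableEquiv (MeasurableEquiv.piFinSuccAbove (fun _ => α) 0),
      (measurePreserving_piFinSuccAbove μ 0).map_eq, (measurePreserving_piFinSuccAbove ν 0).map_eq,
      klDiv_prod, Fin.sum_univ_succ, ih]
    simp

/-- Fenchel's inequality for the conjugate pair `klFun` and `exp - 1`. -/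
theorem mul_le_klFun_add_exp {x : ℝ} (hx : 0 ≤ x) (t : ℝ) :
    t * x ≤ klFun x + Real.exp t := by
  rcases hx.eq_or_lt with rfl | hx
  · simp [klFun_zero]; positivity
  have h := Real.add_one_le_exp (t - Real.log x)
  rw [Real.exp_sub, Real.exp_log hx, le_div_iff₀ hx] at h
  rw [klFun_apply]
  nlinarith

/-- Fenchel's inequality for the density of μ, integrated over `A`. It replaces Fano's inequality in
the converse. -/
theorem mul_measure_le_klDiv_add (μ ν : Measure α) [IsFiniteMeasure μ] [IsFiniteMeasure ν]
    (A : Set α) {t : ℝ} (ht : 0 ≤ t) :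
    ENNReal.ofReal t * μ A ≤ klDiv μ ν + ENNReal.ofReal (Real.exp t) * ν A := by
  by_cases hac : μ ≪ ν
  swap
  · simp [klDiv_of_not_ac hac]
  rw [klDiv_eq_lintegral_klFun_of_ac hac]
  have hfin : ∀ᵐ x ∂ν, μ.rnDeriv ν x < ∞ := Measure.rnDeriv_lt_top μ ν
  -- `A` may fail to be measurable; its hull for ν has the same ν-measure.
  calc ENNReal.ofReal t * μ A ≤ ENNReal.ofReal t * μ (toMeasurable ν A) := by
        gcongr; exact subset_toMeasurable ν A
    _ = ∫⁻ x in toMeasurable ν A, ENNReal.ofReal t * μ.rnDeriv ν x ∂ν := by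
        rw [lintegral_const_mul _ (Measure.measurable_rnDeriv μ ν),
          Measure.setLIntegral_rnDeriv hac]
    _ ≤ ∫⁻ x in toMeasurable ν A, (ENNReal.ofReal (klFun (μ.rnDeriv ν x).toReal) +
          ENNReal.ofReal (Real.exp t)) ∂ν := by
        refine lintegral_mono_ae (ae_restrict_of_ae ?_)
        filter_upwards [hfin] with x hx
        rw [← ENNReal.ofReal_add (klFun_nonneg ENNReal.toReal_nonneg) (Real.exp_pos t).le]
        nth_rw 1 [← ENNReal.ofReal_toReal hx.ne]
        rw [← ENNReal.ofReal_mul ht]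
        exact ENNReal.ofReal_le_ofReal (mul_le_klFun_add_exp ENNReal.toReal_nonneg t)
    _ ≤ _ := by
        rw [lintegral_add_right _ measurable_const, setLIntegral_const, measure_toMeasurable]
        gcongr
        exact Measure.restrict_le_self

theorem compProd_eq_withDensity_rnDeriv [StandardBorelSpace β] (μ : Measure α)
    [IsFiniteMeasure μ] (κ η : Kernel α β) [IsFiniteKernel κ] [IsFiniteKernel η]
    (h : ∀ᵐ a ∂μ, κ a ≪ η a) :
    μ ⊗ₘ κ = (μ ⊗ₘ η).withDensity fun p => κ.rnDeriv η p.1 p.2 := by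
  ext s hs
  rw [Measure.compProd_apply hs, withDensity_apply _ hs, ← lintegral_indicator hs,
    Measure.lintegral_compProd ((Kernel.measurable_rnDeriv κ η).indicator hs)]
  refine lintegral_congr_ae ?_
  filter_upwards [h] with a ha
  have hs' : MeasurableSet (Prod.mk a ⁻¹' s) := measurable_prodMk_left hs
  calc κ a (Prod.mk a ⁻¹' s) = (η a).withDensity (κ.rnDeriv η a) (Prod.mk a ⁻¹' s) := by
        rw [← Kernel.withDensity_apply _ (Kernel.measurable_rnDeriv κ η),
          Kernel.withDensity_rnDeriv_eq ha]
    _ = _ := by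
        rw [withDensity_apply _ hs', ← lintegral_indicator hs']
        rfl

/-- Under absolute continuity, the density of the joint laws is the density of the kernels, so both
sides agree; otherwise the right side is infinite. -/
theorem lintegral_klDiv_le_klDiv_compProd [StandardBorelSpace β] (μ : Measure α)
    [IsFiniteMeasure μ] (κ η : Kernel α β) [IsMarkovKernel κ] [IsMarkovKernel η] :
    ∫⁻ a, klDiv (κ a) (η a) ∂μ ≤ klDiv (μ ⊗ₘ κ) (μ ⊗ₘ η) := by
  by_cases hac : μ ⊗ₘ κ ≪ μ ⊗ₘ η
  swap
  · simp [klDiv_of_not_ac hac]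
  have hae : ∀ᵐ a ∂μ, κ a ≪ η a := Measure.absolutelyContinuous_compProd_right_iff.1 hac
  have hm := Kernel.measurable_rnDeriv κ η
  have hd : (μ ⊗ₘ κ).rnDeriv (μ ⊗ₘ η) =ᵐ[μ ⊗ₘ η] fun p => κ.rnDeriv η p.1 p.2 := by
    conv_lhs => rw [compProd_eq_withDensity_rnDeriv μ κ η hae]
    exact Measure.rnDeriv_withDensity _ hm
  rw [klDiv_eq_lintegral_klFun_of_ac hac, lintegral_congr_ae
    (g := fun p : α × β => ENNReal.ofReal (klFun (κ.rnDeriv η p.1 p.2).toReal))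
    (by filter_upwards [hd] with p hp; rw [hp]),
    Measure.lintegral_compProd (by fun_prop)]
  refine le_of_eq (lintegral_congr_ae ?_)
  filter_upwards [hae] with a ha
  rw [klDiv_eq_lintegral_klFun_of_ac ha]
  refine lintegral_congr_ae ?_
  filter_upwards [Kernel.rnDeriv_eq_rnDeriv_measure (κ := κ) (η := η) (a := a)] with b hb
  rw [hb]

/-- The density of ν with respect to ν' is at most c, so changing the reference measure from ν to ν'
raises the log-likelihood ratio by at most log c. -/
theorem klDiv_le_add_log_of_le_smul [Finite α] [MeasurableSingletonClass α]
    (μ ν ν' : Measure α) [IsProbabilityMeasure μ]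
    [IsProbabilityMeasure ν] [IsProbabilityMeasure ν'] {c : ℝ} (hc : 1 ≤ c)
    (h : ν ≤ ENNReal.ofReal c • ν') :
    klDiv μ ν' ≤ klDiv μ ν + ENNReal.ofReal (Real.log c) := by
  by_cases hac : μ ≪ ν
  swap
  · simp [klDiv_of_not_ac hac]
  have hνν' : ν ≪ ν' := (Measure.absolutelyContinuous_of_le h).trans
    (Measure.AbsolutelyContinuous.rfl.smul_left _)
  have hac' := hac.trans hνν'
  rw [klDiv_of_ac_of_integrable hac .of_finite, klDiv_of_ac_of_integrable hac' .of_finite]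
  simp only [probReal_univ, add_sub_cancel_right]
  have h0 : 0 ≤ ∫ x, llr μ ν x ∂μ := by
    simpa using integral_llr_add_sub_measure_univ_nonneg hac .of_finite
  rw [← ENNReal.ofReal_add h0 (Real.log_nonneg hc)]
  refine ENNReal.ofReal_le_ofReal ?_
  have hle : ν.rnDeriv ν' ≤ᵐ[ν'] fun _ => ENNReal.ofReal c := by
    refine ae_le_of_forall_setLIntegral_le_of_sigmaFinite (Measure.measurable_rnDeriv _ _) ?_
    intro s hs _
    rw [Measure.setLIntegral_rnDeriv hνν', setLIntegral_const]
    simpa using h s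
  have key : ∀ᵐ x ∂μ, llr μ ν' x ≤ llr μ ν x + Real.log c := by
    filter_upwards [hac'.ae_le (Measure.rnDeriv_mul_rnDeriv (κ := ν') hac), hac'.ae_le hle,
      Measure.rnDeriv_pos hac, hac.ae_le (Measure.rnDeriv_lt_top μ ν),
      hac.ae_le (Measure.rnDeriv_pos hνν'), hac'.ae_le (Measure.rnDeriv_lt_top ν ν')]
      with x h1 h2 h3 h4 h5 h6
    rw [llr, llr, ← h1, Pi.mul_apply, ENNReal.toReal_mul, Real.log_mul
      (ENNReal.toReal_pos h3.ne' h4.ne).ne' (ENNReal.toReal_pos h5.ne' h6.ne).ne']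
    gcongr
    · exact ENNReal.toReal_pos h5.ne' h6.ne
    · exact ENNReal.toReal_le_of_le_ofReal (by linarith) h2
  calc ∫ x, llr μ ν' x ∂μ ≤ ∫ x, (llr μ ν x + Real.log c) ∂μ :=
        integral_mono_ae .of_finite .of_finite key
    _ = _ := by rw [integral_add .of_finite .of_finite]; simp

end KLDivergence

/-! ### Reordering user-indexed tuples along a permutation. -/

section Triples

variable {M : Fin 3 → Type*}

/-- The tuple indexed by the users whose entries at `σ 0, σ 1, σ 2` are `a, b, c`. -/
def assemble (σ : Equiv.Perm (Fin 3)) (p : M (σ 0) × M (σ 1) × M (σ 2)) : ∀ k, M k :=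
  Equiv.piCongrLeft M σ fun i => match i with
    | 0 => p.1
    | 1 => p.2.1
    | 2 => p.2.2

@[simp]
theorem assemble_zero (σ : Equiv.Perm (Fin 3)) (p : M (σ 0) × M (σ 1) × M (σ 2)) :
    assemble σ p (σ 0) = p.1 := Equiv.piCongrLeft_apply_apply M σ _ 0

@[simp]
theorem assemble_one (σ : Equiv.Perm (Fin 3)) (p : M (σ 0) × M (σ 1) × M (σ 2)) :
    assemble σ p (σ 1) = p.2.1 := Equiv.piCongrLeft_apply_apply M σ _ 1

@[simp]
theorem assemble_two (σ : Equiv.Perm (Fin 3)) (p : M (σ 0) × M (σ 1) × M (σ 2)) :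
    assemble σ p (σ 2) = p.2.2 := Equiv.piCongrLeft_apply_apply M σ _ 2

theorem forall_user (σ : Equiv.Perm (Fin 3)) {p : Fin 3 → Prop} :
    (∀ k, p k) ↔ p (σ 0) ∧ p (σ 1) ∧ p (σ 2) := by
  rw [← σ.forall_congr_right (q := p)]
  simp [Fin.forall_fin_succ]

@[simp]
theorem assemble_apply (σ : Equiv.Perm (Fin 3)) (w : ∀ k, M k) :
    assemble σ (w (σ 0), w (σ 1), w (σ 2)) = w :=
  funext ((forall_user σ).2 ⟨by simp, by simp, by simp⟩)

/-- Tuples indexed by the users, as triples listed in the order `σ`. -/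
def assembleEquiv (M : Fin 3 → Type*) (σ : Equiv.Perm (Fin 3)) :
    M (σ 0) × M (σ 1) × M (σ 2) ≃ ∀ k, M k where
  toFun := assemble σ
  invFun w := (w (σ 0), w (σ 1), w (σ 2))
  left_inv p := by simp
  right_inv w := by simp

theorem measurable_assemble [∀ k, MeasurableSpace (M k)] (σ : Equiv.Perm (Fin 3)) :
    Measurable (assemble σ : M (σ 0) × M (σ 1) × M (σ 2) → ∀ k, M k) := by
  refine measurable_pi_iff.2 ((forall_user σ).2 ⟨?_, ?_, ?_⟩)
  · simpa using measurable_fst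
  · simpa using measurable_snd.fst
  · simpa using measurable_snd.snd

end Triples

/-! ### Auxiliary facts on infima, fibers and product measures. -/

section Measure

theorem sum_iInf_eq_iInf_sum {ι κ : Type*} [Fintype ι] [Nonempty κ] (g : ι → κ → ℝ≥0∞) :
    ∑ i, ⨅ k, g i k = ⨅ r : ι → κ, ∑ i, g i (r i) := by
  rw [ENNReal.iInf_sum]
  · exact Finset.sum_congr rfl fun i _ =>
      ((Function.surjective_eval (β := fun _ : ι => κ) i).iInf_comp (g i)).symm
  · classical
    intro s r r'
    -- The coordinatewise better of the two choices witnesses directedness.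
    refine ⟨fun i => if g i (r i) ≤ g i (r' i) then r i else r' i, fun i _ => ?_⟩
    dsimp only
    split_ifs with h
    · exact ⟨le_rfl, h⟩
    · exact ⟨(not_le.1 h).le, le_rfl⟩

theorem sum_measure_inter_fiber {α : Type*} [MeasurableSpace α] (μ : Measure α) {N : ℕ}
    (S : Set α) {f : α → Fin N} (hf : Measurable f) :
    ∑ c, μ {y | y ∈ S ∧ f y = c} = μ S := by
  have h := sum_measure_preimage_singleton (μ := μ.restrict S) Finset.univ (f := f)
    fun c _ => hf (measurableSet_singleton c)
  simp only [Finset.coe_univ, Set.preimage_univ, Measure.restrict_apply_univ] at h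
  rw [← h]
  refine Finset.sum_congr rfl fun c _ => ?_
  rw [Measure.restrict_apply (hf (measurableSet_singleton c)), Set.inter_comm]
  rfl

theorem pi_preimage_congr {α β : Type*} [MeasurableSpace α] [MeasurableSpace β] {n : ℕ}
    {μ ν : Fin n → Measure α} [∀ i, IsProbabilityMeasure (μ i)]
    [∀ i, IsProbabilityMeasure (ν i)] {g : α → β} (hg : Measurable g)
    (h : ∀ i, (μ i).map g = (ν i).map g) {T : Set (Fin n → β)} (hT : MeasurableSet T) :
    Measure.pi μ {y | (fun i => g (y i)) ∈ T} = Measure.pi ν {y | (fun i => g (y i)) ∈ T} := by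
  have hG : Measurable fun (y : Fin n → α) i => g (y i) := by fun_prop
  have key : ∀ (ρ : Fin n → Measure α) [∀ i, IsProbabilityMeasure (ρ i)],
      Measure.pi ρ {y | (fun i => g (y i)) ∈ T} = Measure.pi (fun i => (ρ i).map g) T := by
    intro ρ _
    have : ∀ i, IsProbabilityMeasure ((ρ i).map g) := fun i =>
      Measure.isProbabilityMeasure_map hg.aemeasurable
    rw [← Measure.pi_map_pi (fun i => hg.aemeasurable), Measure.map_apply hG hT]
    rfl
  rw [key, key, funext h]

theorem lintegral_map_of_finite {α β : Type*} [Fintype α] [MeasurableSpace α]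
    [MeasurableSingletonClass α] [MeasurableSpace β] [MeasurableSingletonClass β]
    (μ : Measure α) (g : α → β) (f : β → ℝ≥0∞) :
    ∫⁻ x, f x ∂(μ.map g) = ∑ a, f (g a) * μ {a} := by
  have hg : Measurable g := measurable_of_finite g
  conv_lhs => rw [← Measure.sum_smul_dirac μ]
  rw [Measure.map_sum hg.aemeasurable, lintegral_sum_measure, tsum_fintype]
  refine Finset.sum_congr rfl fun a _ => ?_
  rw [Measure.map_smul, lintegral_smul_measure, Measure.map_dirac' hg, lintegral_dirac,
    smul_eq_mul, mul_comm]

end Measure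

/-! ### Converse for codes: comparison with causal channels. -/

section Converse

variable {X Y : Fin 3 → Type*} [∀ k, MeasurableSpace (X k)] [∀ k, MeasurableSpace (Y k)]

/-- A channel, measurable or not, in which, with the users in the order `a, b, c = σ 0, σ 1, σ 2`,
the output `Y_a` is independent of the inputs, `(Y_a, Y_b)` depends only on the input of user `a`,
and `(Y_a, Y_b, Y_c)` only on those of users `a` and `b`. -/
structure Causal (σ : Equiv.Perm (Fin 3)) (r : (∀ k, X k) → Measure (∀ k, Y k)) : Prop where
  isProb : ∀ x, IsProbabilityMeasure (r x)
  congr₁ : ∀ x x', (r x).map (fun y => y (σ 0)) = (r x').map fun y => y (σ 0)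
  congr₂ : ∀ x x', x (σ 0) = x' (σ 0) →
    (r x).map (fun y => (y (σ 0), y (σ 1))) = (r x').map fun y => (y (σ 0), y (σ 1))
  congr₃ : ∀ x x', x (σ 0) = x' (σ 0) → x (σ 1) = x' (σ 1) → r x = r x'

omit [∀ k, MeasurableSpace (X k)] in
theorem Causal.const (σ : Equiv.Perm (Fin 3)) (μ : Measure (∀ k, Y k)) [IsProbabilityMeasure μ] :
    Causal σ fun _ : ∀ k, X k => μ where
  isProb _ := inferInstance
  congr₁ _ _ := rfl
  congr₂ _ _ _ := rfl
  congr₃ _ _ _ _ := rfl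

/-- The least conditional divergence of the channel `V` from a causal channel when the inputs are
independent with laws `p`. -/
noncomputable def causalDiv (V : Kernel (∀ k, X k) (∀ k, Y k)) (σ : Equiv.Perm (Fin 3))
    (p : ∀ k, Measure (X k)) : ℝ≥0∞ :=
  ⨅ r : {r : (∀ k, X k) → Measure (∀ k, Y k) // Causal σ r},
    ∫⁻ x, klDiv (V x) (r.1 x) ∂(Measure.pi p)

/-- Each user's error event involves only that user's output block, whose law is the same under V
and W. The factor 3 is the union bound over users. -/
theorem SameMarginals.errorProb_le {W V : Kernel (∀ k, X k) (∀ k, Y k)} [IsMarkovKernel W]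
    [IsMarkovKernel V] (h : SameMarginals W V) {n : ℕ} (c : Code X Y n) :
    c.errorProb V ≤ 3 * c.errorProb W := by
  unfold Code.errorProb
  rw [← mul_div_assoc, Finset.mul_sum]
  refine ENNReal.div_le_div_right (Finset.sum_le_sum fun w _ => ?_) _
  have hset : ∀ k, MeasurableSet {z : Fin n → Y k | c.dec k z ≠ w k} := fun k =>
    (c.measurable_dec k (measurableSet_singleton (w k))).compl
  have hk : ∀ k, c.outputLaw V w {y | c.dec k (fun i => y i k) ≠ w k} ≤
      c.outputLaw W w {y | ∃ k, c.dec k (fun i => y i k) ≠ w k} := fun k =>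
    (pi_preimage_congr (measurable_pi_apply k) (fun i => h k _) (hset k)).trans_le
      (measure_mono fun y hy => ⟨k, hy⟩)
  calc c.outputLaw V w {y | ∃ k, c.dec k (fun i => y i k) ≠ w k}
      ≤ ∑ k, c.outputLaw V w {y | c.dec k (fun i => y i k) ≠ w k} := by
        rw [Set.ofPred_exists]
        exact measure_iUnion_fintype_le _ _
    _ ≤ ∑ _k : Fin 3, c.outputLaw W w {y | ∃ k, c.dec k (fun i => y i k) ≠ w k} :=
        Finset.sum_le_sum fun k _ => hk k
    _ = _ := by simp

omit [∀ k, MeasurableSpace (X k)] in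
/-- Over causal channels, decoding all three messages correctly is guessing. -/
theorem sum_causal_correct_le_one {n : ℕ} (c : Code X Y n) (σ : Equiv.Perm (Fin 3))
    (r : Fin n → (∀ k, X k) → Measure (∀ k, Y k)) (hr : ∀ i, Causal σ (r i)) :
    ∑ w : ∀ k, Fin (c.numMsg k), (Measure.pi fun i => r i fun k => c.enc k (w k) i)
      {y | ∀ k, c.dec k (fun i => y i k) = w k} ≤ 1 := by
  have := fun i => (hr i).isProb
  let D : ∀ j : Fin 3, (Fin n → ∀ k, Y k) → Fin (c.numMsg (σ j)) :=
    fun j y => c.dec (σ j) fun i => y i (σ j)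
  have hD : ∀ j, Measurable (D j) := fun j => (c.measurable_dec _).comp (by fun_prop)
  let ν : (∀ k, Fin (c.numMsg k)) → Measure (Fin n → ∀ k, Y k) :=
    fun w => Measure.pi fun i => r i fun k => c.enc k (w k) i
  have : ∀ w, IsProbabilityMeasure (ν w) := fun w => by dsimp only [ν]; infer_instance
  let b₀ : Fin (c.numMsg (σ 1)) := ⟨0, c.numMsg_pos _⟩
  let c₀ : Fin (c.numMsg (σ 2)) := ⟨0, c.numMsg_pos _⟩
  let a₀ : Fin (c.numMsg (σ 0)) := ⟨0, c.numMsg_pos _⟩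
  have h3 : ∀ a b d, ν (assemble σ (a, b, d)) = ν (assemble σ (a, b, c₀)) := fun a b d => by
    dsimp only [ν]
    congr 1
    funext i
    exact (hr i).congr₃ _ _ (by simp) (by simp)
  have h2 : ∀ a b, ν (assemble σ (a, b, c₀)) {y | D 0 y = a ∧ D 1 y = b} =
      ν (assemble σ (a, b₀, c₀)) {y | D 0 y = a ∧ D 1 y = b} := fun a b =>
    pi_preimage_congr (g := fun y : ∀ k, Y k => (y (σ 0), y (σ 1))) (by fun_prop)
      (fun i => (hr i).congr₂ _ _ (by simp))
      (T := {z | c.dec (σ 0) (fun i => (z i).1) = a ∧ c.dec (σ 1) (fun i => (z i).2) = b})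
      (((c.measurable_dec (σ 0)).comp (by fun_prop) (measurableSet_singleton a)).inter
        ((c.measurable_dec (σ 1)).comp (by fun_prop) (measurableSet_singleton b)))
  have h1 : ∀ a, ν (assemble σ (a, b₀, c₀)) {y | D 0 y = a} =
      ν (assemble σ (a₀, b₀, c₀)) {y | D 0 y = a} := fun a =>
    pi_preimage_congr (g := fun y : ∀ k, Y k => y (σ 0)) (by fun_prop)
      (fun i => (hr i).congr₁ _ _)
      (T := {z | c.dec (σ 0) z = a}) (c.measurable_dec (σ 0) (measurableSet_singleton a))
  -- The last user is summed out first: the law ignores its message, and its decoding events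
  -- partition the space. What remains is an event in (Y_a, Y_b), whose law ignores the second
  -- message, and the same argument repeats.
  calc ∑ w, ν w {y | ∀ k, c.dec k (fun i => y i k) = w k}
      = ∑ a, ∑ b, ∑ d, ν (assemble σ (a, b, c₀)) {y | (D 0 y = a ∧ D 1 y = b) ∧ D 2 y = d} := by
        rw [← (assembleEquiv _ σ).sum_comp, Fintype.sum_prod_type]
        refine Finset.sum_congr rfl fun a _ => ?_
        rw [Fintype.sum_prod_type]
        refine Finset.sum_congr rfl fun b _ => Finset.sum_congr rfl fun d _ => ?_
        change ν (assemble σ (a, b, d)) _ = _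
        rw [h3]
        congr 1
        ext y
        simp [forall_user σ, assembleEquiv, D, and_assoc]
    _ = ∑ a, ∑ b, ν (assemble σ (a, b₀, c₀)) {y | D 0 y = a ∧ D 1 y = b} := by
        refine Finset.sum_congr rfl fun a _ => Finset.sum_congr rfl fun b _ => ?_
        rw [← h2]
        exact sum_measure_inter_fiber _ {y | D 0 y = a ∧ D 1 y = b} (hD 2)
    -- The conjunct `True` is membership in `Set.univ`, the form needed for the last summation over
    -- fibers.
    _ = ∑ a, ν (assemble σ (a₀, b₀, c₀)) {y | True ∧ D 0 y = a} := by
        refine Finset.sum_congr rfl fun a _ => ?_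
        simp only [true_and]
        rw [← h1]
        exact sum_measure_inter_fiber _ {y | D 0 y = a} (hD 1)
    _ ≤ 1 := (sum_measure_inter_fiber _ Set.univ (hD 0)).trans_le prob_le_one

/-- The change-of-measure inequality is applied, message by message, to the event of correct
decoding. Since exp t ≤ N, averaging over messages leaves the guessing sum as the final term 1. -/
theorem Code.converse {n : ℕ} (c : Code X Y n) (V : Kernel (∀ k, X k) (∀ k, Y k))
    [IsMarkovKernel V] (σ : Equiv.Perm (Fin 3))
    (r : Fin n → (∀ k, X k) → Measure (∀ k, Y k)) (hr : ∀ i, Causal σ (r i)) {t : ℝ}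
    (ht : 0 ≤ t) (htN : ENNReal.ofReal (Real.exp t) ≤ ∏ k, (c.numMsg k : ℝ≥0∞)) :
    ENNReal.ofReal t ≤ ENNReal.ofReal t * c.errorProb V +
      ∑ i, (∑ w : ∀ k, Fin (c.numMsg k), klDiv (V fun k => c.enc k (w k) i)
        (r i fun k => c.enc k (w k) i)) / ∏ k, (c.numMsg k : ℝ≥0∞) + 1 := by
  have := fun i => (hr i).isProb
  set N : ℝ≥0∞ := ∏ k, (c.numMsg k : ℝ≥0∞) with hN
  have hN0 : N ≠ 0 := Finset.prod_ne_zero_iff.2 fun k _ => by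
    simpa using (c.numMsg_pos k).ne'
  have hNt : N ≠ ∞ := ENNReal.prod_ne_top fun k _ => ENNReal.natCast_ne_top _
  have hcard : ∑ _w : ∀ k, Fin (c.numMsg k), (1 : ℝ≥0∞) = N := by simp [hN]
  let C : (∀ k, Fin (c.numMsg k)) → Set (Fin n → ∀ k, Y k) :=
    fun w => {y | ∀ k, c.dec k (fun i => y i k) = w k}
  have hC : ∀ w, MeasurableSet (C w) := fun w => by
    have : C w = ⋂ k, {y | c.dec k (fun i => y i k) = w k} := by
      ext y; simp [C]
    rw [this]
    exact MeasurableSet.iInter fun k =>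
      (c.measurable_dec k).comp (by fun_prop) (measurableSet_singleton (w k))
  have hprob : ∀ w, IsProbabilityMeasure (c.outputLaw V w) := fun w => by
    unfold Code.outputLaw; infer_instance
  have hw : ∀ w, ENNReal.ofReal t ≤
      ENNReal.ofReal t * c.outputLaw V w {y | ∃ k, c.dec k (fun i => y i k) ≠ w k} +
      ∑ i, klDiv (V fun k => c.enc k (w k) i) (r i fun k => c.enc k (w k) i) +
      N * (Measure.pi fun i => r i fun k => c.enc k (w k) i) (C w) := by
    intro w
    have hcompl : {y | ∃ k, c.dec k (fun i => y i k) ≠ w k} = (C w)ᶜ := by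
      ext y; simp [C]
    have h := mul_measure_le_klDiv_add (c.outputLaw V w)
      (Measure.pi fun i => r i fun k => c.enc k (w k) i) (C w) ht
    rw [Code.outputLaw, klDiv_pi, ← Code.outputLaw] at h
    calc ENNReal.ofReal t = ENNReal.ofReal t * c.outputLaw V w (C w)ᶜ +
          ENNReal.ofReal t * c.outputLaw V w (C w) := by
          rw [← mul_add, add_comm, prob_add_prob_compl (hC w), mul_one]
      _ ≤ _ := by
          rw [hcompl, add_assoc]
          gcongr
          refine h.trans ?_
          gcongr
  have hsum := Finset.sum_le_sum fun w (_ : w ∈ Finset.univ) => hw w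
  rw [Finset.sum_add_distrib, Finset.sum_add_distrib, ← Finset.mul_sum, ← Finset.mul_sum,
    Finset.sum_comm] at hsum
  have hlhs : ∑ _w : ∀ k, Fin (c.numMsg k), ENNReal.ofReal t = ENNReal.ofReal t * N := by
    rw [← hcard, Finset.mul_sum]; simp
  rw [hlhs] at hsum
  have hone := sum_causal_correct_le_one c σ r hr
  calc ENNReal.ofReal t = ENNReal.ofReal t * N / N := by
        rw [mul_div_assoc, ENNReal.div_self hN0 hNt, mul_one]
    _ ≤ _ := ENNReal.div_le_div_right hsum N
    _ ≤ _ := by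
        rw [ENNReal.add_div, ENNReal.add_div, mul_div_assoc, Code.errorProb]
        have hdiv : ∀ f : Fin n → ℝ≥0∞, (∑ i, f i) / N = ∑ i, f i / N := fun f => by
          simp only [div_eq_mul_inv, Finset.sum_mul]
        rw [hdiv]
        gcongr
        rw [mul_comm, mul_div_assoc, ENNReal.div_self hN0 hNt, mul_one]
        exact hone

/-- The inputs of a code at a uniformly distributed time, for uniformly distributed messages. -/
noncomputable def Code.inputDist {n : ℕ} [Nonempty (Fin n)] (c : Code X Y n) :
    InputDist X (Fin n) where
  lawQ := (PMF.uniformOfFintype (Fin n)).toMeasure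
  isProb := inferInstance
  inp k :=
    { toFun := fun i =>
        haveI : Nonempty (Fin (c.numMsg k)) := ⟨⟨0, c.numMsg_pos k⟩⟩
        (PMF.uniformOfFintype (Fin (c.numMsg k))).toMeasure.map fun w => c.enc k w i
      measurable' := measurable_of_finite _ }
  isMarkov k := ⟨fun _ =>
    haveI : Nonempty (Fin (c.numMsg k)) := ⟨⟨0, c.numMsg_pos k⟩⟩
    Measure.isProbabilityMeasure_map (measurable_of_finite _).aemeasurable⟩

theorem Code.lintegral_inputDist [∀ k, MeasurableSingletonClass (X k)] {n : ℕ}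
    [Nonempty (Fin n)] (c : Code X Y n) (i : Fin n) (f : (∀ k, X k) → ℝ≥0∞) :
    ∫⁻ x, f x ∂(Measure.pi fun k => c.inputDist.inp k i) =
      (∑ w : ∀ k, Fin (c.numMsg k), f fun k => c.enc k (w k) i) /
        ∏ k, (c.numMsg k : ℝ≥0∞) := by
  have hne : ∀ k, Nonempty (Fin (c.numMsg k)) := fun k => ⟨⟨0, c.numMsg_pos k⟩⟩
  have hmap : (Measure.pi fun k => c.inputDist.inp k i) =
      (Measure.pi fun k => (PMF.uniformOfFintype (Fin (c.numMsg k))).toMeasure).map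
        fun w k => c.enc k (w k) i := by
    have : ∀ k, IsProbabilityMeasure
        ((PMF.uniformOfFintype (Fin (c.numMsg k))).toMeasure.map fun w => c.enc k w i) :=
      fun k => Measure.isProbabilityMeasure_map (measurable_of_finite _).aemeasurable
    exact (Measure.pi_map_pi (f := fun k w => c.enc k w i)
      fun k => (measurable_of_finite _).aemeasurable).symm
  rw [hmap, lintegral_map_of_finite, div_eq_mul_inv, Finset.sum_mul]
  refine Finset.sum_congr rfl fun w _ => ?_
  rw [Measure.pi_singleton]
  simp only [PMF.toMeasure_apply_singleton _ _ (measurableSet_singleton _),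
    PMF.uniformOfFintype_apply, Fintype.card_fin]
  rw [ENNReal.prod_inv_distrib]
  intro j _ k _ _
  exact Or.inr (ENNReal.natCast_ne_top _)

theorem Code.converse_causalDiv [∀ k, MeasurableSingletonClass (X k)] [∀ k, Nonempty (Y k)]
    {n : ℕ} [Nonempty (Fin n)] (c : Code X Y n)
    (V : Kernel (∀ k, X k) (∀ k, Y k)) [IsMarkovKernel V] (σ : Equiv.Perm (Fin 3)) {t : ℝ}
    (ht : 0 ≤ t) (htN : ENNReal.ofReal (Real.exp (n * t)) ≤ ∏ k, (c.numMsg k : ℝ≥0∞)) :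
    ENNReal.ofReal t ≤
      ∫⁻ q, causalDiv V σ (fun k => c.inputDist.inp k q) ∂c.inputDist.lawQ +
      (ENNReal.ofReal t * c.errorProb V + (n : ℝ≥0∞)⁻¹) := by
  have hn : (n : ℝ≥0∞) ≠ 0 := by
    have := Fin.pos_iff_nonempty.2 ‹Nonempty (Fin n)›
    simpa using this.ne'
  have hnt := ENNReal.natCast_ne_top n
  have : Nonempty {r : (∀ k, X k) → Measure (∀ k, Y k) // Causal σ r} :=
    ⟨⟨_, Causal.const σ (Measure.dirac (Classical.arbitrary _))⟩⟩
  have hsum : ENNReal.ofReal (n * t) ≤ ENNReal.ofReal (n * t) * c.errorProb V +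
      ∑ i, causalDiv V σ (fun k => c.inputDist.inp k i) + 1 := by
    -- The reference channel may be chosen separately at each time, so the sum of infima is an
    -- infimum over sequences of channels.
    have hinf : ∑ i, causalDiv V σ (fun k => c.inputDist.inp k i) =
        ⨅ r : Fin n → {r : (∀ k, X k) → Measure (∀ k, Y k) // Causal σ r},
          ∑ i, ∫⁻ x, klDiv (V x) ((r i).1 x) ∂(Measure.pi fun k => c.inputDist.inp k i) := by
      exact sum_iInf_eq_iInf_sum _
    rw [hinf, ENNReal.add_iInf, ENNReal.iInf_add]
    refine le_iInf fun r => ?_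
    have h := c.converse V σ (fun i => (r i).1) (fun i => (r i).2) (by positivity) htN
    simpa only [c.lintegral_inputDist] using h
  have hint : ∫⁻ q, causalDiv V σ (fun k => c.inputDist.inp k q) ∂c.inputDist.lawQ =
      (∑ i, causalDiv V σ (fun k => c.inputDist.inp k i)) * (n : ℝ≥0∞)⁻¹ := by
    rw [lintegral_fintype, Finset.sum_mul]
    refine Finset.sum_congr rfl fun i _ => ?_
    simp [Code.inputDist, PMF.toMeasure_apply_singleton _ _ (measurableSet_singleton _)]
  rw [hint]
  have h := mul_le_mul_left hsum (n : ℝ≥0∞)⁻¹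
  rw [ENNReal.ofReal_mul (by positivity), ENNReal.ofReal_natCast] at h
  have hcancel : ∀ z : ℝ≥0∞, n * z * (n : ℝ≥0∞)⁻¹ = z := fun z => by
    rw [mul_right_comm, ENNReal.mul_inv_cancel hn hnt, one_mul]
  rw [hcancel, add_mul, add_mul, one_mul, mul_assoc (n : ℝ≥0∞), hcancel] at h
  refine h.trans (le_of_eq ?_)
  ring

/-- The outer bound on the sum rate `s` expressed through `causalDiv`. -/
def CausalBound (W : Kernel (∀ k, X k) (∀ k, Y k)) (s : ℝ) : Prop :=
  ∀ ε : ℝ, 0 < ε → ∃ (m : ℕ) (P : InputDist X (Fin m)),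
    ∀ (σ : Equiv.Perm (Fin 3)) (V : Kernel (∀ k, X k) (∀ k, Y k)) [IsMarkovKernel V],
      SameMarginals W V → ENNReal.ofReal s ≤
        ∫⁻ q, causalDiv V σ (fun k => P.inp k q) ∂P.lawQ + ENNReal.ofReal ε

theorem Achievable.causalBound [∀ k, MeasurableSingletonClass (X k)] [∀ k, Nonempty (Y k)]
    {W : Kernel (∀ k, X k) (∀ k, Y k)} [IsMarkovKernel W] {R : Fin 3 → ℝ} (h : Achievable W R) :
    CausalBound W (R 0 + R 1 + R 2) := by
  intro ε hε
  obtain ⟨hR, c, hrate, herr⟩ := h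
  have hs : 0 ≤ R 0 + R 1 + R 2 := by linarith [hR 0, hR 1, hR 2]
  -- The error terms involve only W, so a single block length works for all V and σ.
  have hlim : Tendsto (fun n : ℕ => ENNReal.ofReal (R 0 + R 1 + R 2) *
      (3 * (c n).errorProb W) + (n : ℝ≥0∞)⁻¹) atTop (𝓝 0) := by
    have h1 := ENNReal.Tendsto.const_mul (a := 3) herr (Or.inr (by simp))
    have h2 := ENNReal.Tendsto.const_mul (a := ENNReal.ofReal (R 0 + R 1 + R 2)) h1
      (Or.inr ENNReal.ofReal_ne_top)
    simpa using h2.add ENNReal.tendsto_inv_nat_nhds_zero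
  obtain ⟨n, hn, hn1⟩ := ((hlim.eventually_le_const (ENNReal.ofReal_pos.2 hε)).and
    (eventually_ge_atTop 1)).exists
  have : Nonempty (Fin n) := Fin.pos_iff_nonempty.1 hn1
  refine ⟨n, (c n).inputDist, fun σ V _ hV => ?_⟩
  refine ((c n).converse_causalDiv V σ hs ?_).trans ?_
  · rw [Fin.prod_univ_three]
    have : Real.exp (n * (R 0 + R 1 + R 2)) ≤
        (c n).numMsg 0 * (c n).numMsg 1 * (c n).numMsg 2 := by
      rw [mul_add, mul_add, Real.exp_add, Real.exp_add]
      gcongr <;> exact hrate n _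
    refine (ENNReal.ofReal_le_ofReal this).trans (le_of_eq ?_)
    rw [ENNReal.ofReal_mul (by positivity), ENNReal.ofReal_mul (by positivity)]
    simp
  · gcongr
    refine le_trans ?_ hn
    gcongr
    exact hV.errorProb_le (c n)

end Converse

/-! ### Time sharing and passage to the convex closure. -/

section Convexity

variable {X Y : Fin 3 → Type*} [∀ k, MeasurableSpace (X k)] [∀ k, MeasurableSpace (Y k)]
  {W : Kernel (∀ k, X k) (∀ k, Y k)}

/-- The mixture of two input distributions, with disjoint alphabets for the time-sharing
variable. -/
noncomputable def InputDist.mix {m₁ m₂ : ℕ} (P₁ : InputDist X (Fin m₁))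
    (P₂ : InputDist X (Fin m₂)) {a b : ℝ} (ha : 0 ≤ a) (hb : 0 ≤ b) (hab : a + b = 1) :
    InputDist X (Fin (m₁ + m₂)) where
  lawQ := ENNReal.ofReal a • P₁.lawQ.map (Fin.castAdd m₂) +
    ENNReal.ofReal b • P₂.lawQ.map (Fin.natAdd m₁)
  isProb := ⟨by
    have h₁ := Measure.isProbabilityMeasure_map (μ := P₁.lawQ)
      (measurable_of_finite (Fin.castAdd m₂)).aemeasurable
    have h₂ := Measure.isProbabilityMeasure_map (μ := P₂.lawQ)
      (measurable_of_finite (Fin.natAdd m₁)).aemeasurable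
    simp [← ENNReal.ofReal_add ha hb, hab]⟩
  inp k :=
    { toFun := Fin.addCases (P₁.inp k) (P₂.inp k)
      measurable' := measurable_of_finite _ }
  isMarkov k := ⟨fun i => by
    change IsProbabilityMeasure
      (Fin.addCases (motive := fun _ => Measure (X k)) (P₁.inp k) (P₂.inp k) i)
    refine Fin.addCases (fun j => ?_) (fun j => ?_) i
    · rw [Fin.addCases_left]; infer_instance
    · rw [Fin.addCases_right]; infer_instance⟩

theorem InputDist.lintegral_mix {m₁ m₂ : ℕ} (P₁ : InputDist X (Fin m₁))
    (P₂ : InputDist X (Fin m₂)) {a b : ℝ} (ha : 0 ≤ a) (hb : 0 ≤ b) (hab : a + b = 1)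
    (F : (∀ k, Measure (X k)) → ℝ≥0∞) :
    ∫⁻ q, F (fun k => (P₁.mix P₂ ha hb hab).inp k q) ∂(P₁.mix P₂ ha hb hab).lawQ =
      ENNReal.ofReal a * ∫⁻ q, F (fun k => P₁.inp k q) ∂P₁.lawQ +
      ENNReal.ofReal b * ∫⁻ q, F (fun k => P₂.inp k q) ∂P₂.lawQ := by
  have hl : ∀ k i, (P₁.mix P₂ ha hb hab).inp k (Fin.castAdd m₂ i) = P₁.inp k i := fun k i =>
    Fin.addCases_left (motive := fun _ => Measure (X k)) i
  have hr : ∀ k i, (P₁.mix P₂ ha hb hab).inp k (Fin.natAdd m₁ i) = P₂.inp k i := fun k i =>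
    Fin.addCases_right (motive := fun _ => Measure (X k)) i
  conv_lhs => rw [show (P₁.mix P₂ ha hb hab).lawQ = ENNReal.ofReal a • P₁.lawQ.map
    (Fin.castAdd m₂) + ENNReal.ofReal b • P₂.lawQ.map (Fin.natAdd m₁) from rfl]
  rw [lintegral_add_measure, lintegral_smul_measure, lintegral_smul_measure,
    lintegral_map (measurable_of_finite _) (measurable_of_finite _),
    lintegral_map (measurable_of_finite _) (measurable_of_finite _)]
  simp only [hl, hr, smul_eq_mul]

theorem CausalBound.convex {s₁ s₂ : ℝ} (h₁ : CausalBound W s₁) (h₂ : CausalBound W s₂) {a b : ℝ}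
    (ha : 0 ≤ a) (hb : 0 ≤ b) (hab : a + b = 1) : CausalBound W (a * s₁ + b * s₂) := by
  intro ε hε
  obtain ⟨m₁, P₁, hP₁⟩ := h₁ ε hε
  obtain ⟨m₂, P₂, hP₂⟩ := h₂ ε hε
  refine ⟨m₁ + m₂, P₁.mix P₂ ha hb hab, fun σ V _ hV => ?_⟩
  rw [InputDist.lintegral_mix P₁ P₂ ha hb hab (causalDiv V σ)]
  calc ENNReal.ofReal (a * s₁ + b * s₂)
      ≤ ENNReal.ofReal a * ENNReal.ofReal s₁ + ENNReal.ofReal b * ENNReal.ofReal s₂ := by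
        rw [← ENNReal.ofReal_mul ha, ← ENNReal.ofReal_mul hb]
        exact ENNReal.ofReal_add_le
    _ ≤ _ := add_le_add (mul_le_mul_right (hP₁ σ V hV) _) (mul_le_mul_right (hP₂ σ V hV) _)
    _ = _ := by
        have : ENNReal.ofReal ε = ENNReal.ofReal a * ENNReal.ofReal ε +
            ENNReal.ofReal b * ENNReal.ofReal ε := by
          rw [← add_mul, ← ENNReal.ofReal_add ha hb, hab, ENNReal.ofReal_one, one_mul]
        conv_rhs => rw [this]
        ring

theorem causalBound_of_mem_capacityRegion [∀ k, MeasurableSingletonClass (X k)]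
    [∀ k, Nonempty (Y k)] [IsMarkovKernel W] {R : Fin 3 → ℝ} (h : R ∈ capacityRegion W) :
    CausalBound W (R 0 + R 1 + R 2) := by
  have hconv : convexHull ℝ {R | Achievable W R} ⊆ {R | CausalBound W (R 0 + R 1 + R 2)} := by
    refine convexHull_min (fun R hR => hR.causalBound) ?_
    intro R₁ h₁ R₂ h₂ a b ha hb hab
    have := CausalBound.convex h₁ h₂ ha hb hab
    change CausalBound W _
    convert! this using 1
    simp only [Pi.add_apply, Pi.smul_apply, smul_eq_mul]
    ring
  intro ε hε
  -- Half of ε pays for approximating `R` by a point of the convex hull, the other half for the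
  -- bound at that point.
  have hcont : Continuous fun R : Fin 3 → ℝ => R 0 + R 1 + R 2 := by fun_prop
  obtain ⟨R', hR', hR'R⟩ := mem_closure_iff_nhds.1 h _
    (hcont.continuousAt.preimage_mem_nhds (Ioi_mem_nhds (sub_lt_self _ (half_pos hε))))
  obtain ⟨m, P, hP⟩ := hconv hR'R (ε / 2) (half_pos hε)
  refine ⟨m, P, fun σ V _ hV => ?_⟩
  have hle : R 0 + R 1 + R 2 ≤ (R' 0 + R' 1 + R' 2) + ε / 2 := by
    have : R 0 + R 1 + R 2 - ε / 2 < R' 0 + R' 1 + R' 2 := hR'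
    linarith
  calc ENNReal.ofReal (R 0 + R 1 + R 2)
      ≤ ENNReal.ofReal (R' 0 + R' 1 + R' 2) + ENNReal.ofReal (ε / 2) :=
        (ENNReal.ofReal_le_ofReal hle).trans ENNReal.ofReal_add_le
    _ ≤ _ := add_le_add (hP σ V hV) le_rfl
    _ = _ := by
        rw [add_assoc, ← ENNReal.ofReal_add (by positivity) (by positivity), add_halves]

end Convexity

/-! ### Chain rule for divergence and conditional mutual information. -/

section ChainRule

variable {Ω A B C D : Type*} [MeasurableSpace Ω] [MeasurableSpace A] [MeasurableSpace B]
  [MeasurableSpace C] [MeasurableSpace D]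

theorem measurable_klDiv [StandardBorelSpace B] (κ η : Kernel A B) [IsFiniteKernel κ]
    [IsFiniteKernel η] : Measurable fun a => klDiv (κ a) (η a) := by
  classical
  have h : (fun a => klDiv (κ a) (η a)) = fun a => if κ a ≪ η a then
      ∫⁻ b, ENNReal.ofReal (klFun (κ.rnDeriv η a b).toReal) ∂(η a) else ∞ := by
    funext a
    rw [klDiv_eq_lintegral_klFun]
    congr 1
    refine lintegral_congr_ae ?_
    filter_upwards [Kernel.rnDeriv_eq_rnDeriv_measure (κ := κ) (η := η) (a := a)] with b hb
    rw [hb]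
  rw [h]
  have hm := Kernel.measurable_rnDeriv κ η
  have hf : Measurable fun p : A × B => ENNReal.ofReal (klFun (κ.rnDeriv η p.1 p.2).toReal) := by
    fun_prop
  exact Measurable.ite (Kernel.measurableSet_absolutelyContinuous κ η)
    hf.lintegral_kernel_prod_right' measurable_const

theorem map_prodMk_prodMk (μ : Measure Ω) {Z : Ω → D} {U : Ω → A} {V : Ω → B} (hZ : Measurable Z)
    (hU : Measurable U) (hV : Measurable V) :
    (μ.map fun ω => (Z ω, (U ω, V ω))) =
      (μ.map fun ω => ((Z ω, U ω), V ω)).map MeasurableEquiv.prodAssoc := by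
  rw [Measure.map_map (by fun_prop) (by fun_prop)]
  rfl

theorem klDiv_map_prodMk_eq_add [StandardBorelSpace A] [Nonempty A] (μ : Measure Ω)
    [IsProbabilityMeasure μ] {Z : Ω → D} {U : Ω → A} (hU : Measurable U)
    (ρ : Measure D) [IsFiniteMeasure ρ] (κ : Kernel D A) [IsMarkovKernel κ] :
    klDiv (μ.map fun ω => (Z ω, U ω)) (ρ ⊗ₘ κ) =
      klDiv (μ.map Z) ρ + klDiv (μ.map fun ω => (Z ω, U ω)) (μ.map Z ⊗ₘ κ) := by
  rw [← compProd_map_condDistrib hU.aemeasurable]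
  exact klDiv_compProd_eq_add _ _ _ _

/-- Data processing: `j` turns (T, V) into `Z` and `g` recovers T from it, so both measures are
images of the pair defining I(U; V | T). Conditioning on `Z` instead of (T, V) lets the successive
divergences telescope. -/
theorem klDiv_compProd_condDistrib_le_condMutualInfo [StandardBorelSpace A] [Nonempty A]
    [StandardBorelSpace B] [Nonempty B] (μ : Measure Ω) [IsProbabilityMeasure μ]
    {U : Ω → A} {V : Ω → B} {T : Ω → C} (hU : Measurable U) (hV : Measurable V)
    (hT : Measurable T) {Z : Ω → D} {j : C × B → D} {g : D → C} (hj : Measurable j)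
    (hg : Measurable g) (hjZ : ∀ ω, j (T ω, V ω) = Z ω) (hgj : ∀ p, g (j p) = p.1) :
    klDiv (μ.map fun ω => (Z ω, U ω)) (μ.map Z ⊗ₘ (condDistrib U T μ).comap g hg) ≤
      condMutualInfo μ U V T := by
  have hφ : Measurable fun p : C × A × B => (j (p.1, p.2.2), p.2.1) := by fun_prop
  have h := klDiv_map_le (μ.map fun ω => (T ω, U ω, V ω))
    ((μ.map T) ⊗ₘ (condDistrib U T μ ×ₖ condDistrib V T μ)) hφ
  rw [Measure.map_map hφ (by fun_prop)] at h
  have h1 : ((fun p : C × A × B => (j (p.1, p.2.2), p.2.1)) ∘ fun ω => (T ω, U ω, V ω)) =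
      fun ω => (Z ω, U ω) := by
    funext ω
    simp [hjZ]
  have h2 : ((μ.map T) ⊗ₘ (condDistrib U T μ ×ₖ condDistrib V T μ)).map
      (fun p : C × A × B => (j (p.1, p.2.2), p.2.1)) =
      μ.map Z ⊗ₘ (condDistrib U T μ).comap g hg := by
    have hZ : μ.map Z = ((μ.map T) ⊗ₘ condDistrib V T μ).map j := by
      rw [compProd_map_condDistrib hV.aemeasurable, Measure.map_map hj (by fun_prop)]
      congr 1
      funext ω
      exact (hjZ ω).symm
    refine Measure.ext_of_lintegral _ fun f hf => ?_
    have hm1 : Measurable fun z => ∫⁻ u, f (z, u) ∂((condDistrib U T μ).comap g hg z) :=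
      hf.lintegral_kernel_prod_right'
    have hm2 : Measurable fun p => ∫⁻ u, f (j p, u) ∂((condDistrib U T μ).comap g hg (j p)) :=
      hm1.comp hj
    rw [lintegral_map hf hφ, Measure.lintegral_compProd (by fun_prop),
      Measure.lintegral_compProd hf, hZ, lintegral_map hm1 hj,
      Measure.lintegral_compProd hm2]
    refine lintegral_congr fun t => ?_
    rw [Kernel.prod_apply, lintegral_prod_symm' _ (by fun_prop)]
    refine lintegral_congr fun v => ?_
    rw [Kernel.comap_apply, hgj]
  rw [h1, h2] at h
  exact h

end ChainRule

/-! ### From causal divergence to the three mutual informations. -/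

section SumRate

variable {X Y : Fin 3 → Type*} [∀ k, MeasurableSpace (X k)] [∀ k, MeasurableSpace (Y k)]
  [∀ k, StandardBorelSpace (X k)] [∀ k, Nonempty (X k)]
  [∀ k, StandardBorelSpace (Y k)] [∀ k, Nonempty (Y k)]
  {𝒬 : Type*} [MeasurableSpace 𝒬]

/-- The channel, depending on the time-sharing variable, that generates the outputs one after the
other in the order `σ`, each from the inputs and outputs of the users before it. -/
noncomputable def causalKernel (σ : Equiv.Perm (Fin 3)) (ν : Measure (Y (σ 0)))
    (κ₁ : Kernel (X (σ 0) × Y (σ 0) × 𝒬) (Y (σ 1)))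
    (κ₂ : Kernel (X (σ 0) × Y (σ 0) × X (σ 1) × Y (σ 1) × 𝒬) (Y (σ 2))) :
    Kernel (𝒬 × ∀ k, X k) ((Y (σ 0) × Y (σ 1)) × Y (σ 2)) :=
  (Kernel.const _ ν ⊗ₖ κ₁.comap (fun p => (p.1.2 (σ 0), p.2, p.1.1)) (by fun_prop)) ⊗ₖ
    κ₂.comap (fun p => (p.1.2 (σ 0), p.2.1, p.1.2 (σ 1), p.2.2, p.1.1)) (by fun_prop)

omit [∀ k, StandardBorelSpace (X k)] [∀ k, Nonempty (X k)] [∀ k, StandardBorelSpace (Y k)]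
  [∀ k, Nonempty (Y k)] in
theorem causal_causalKernel (σ : Equiv.Perm (Fin 3)) (ν : Measure (Y (σ 0)))
    [IsProbabilityMeasure ν]
    (κ₁ : Kernel (X (σ 0) × Y (σ 0) × 𝒬) (Y (σ 1))) [IsMarkovKernel κ₁]
    (κ₂ : Kernel (X (σ 0) × Y (σ 0) × X (σ 1) × Y (σ 1) × 𝒬) (Y (σ 2))) [IsMarkovKernel κ₂]
    (q : 𝒬) :
    Causal σ fun x => (causalKernel σ ν κ₁ κ₂ (q, x)).map fun p =>
      assemble σ (p.1.1, p.1.2, p.2) := by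
  have hasm : Measurable fun p : (Y (σ 0) × Y (σ 1)) × Y (σ 2) =>
      assemble σ (p.1.1, p.1.2, p.2) := (measurable_assemble σ).comp (by fun_prop)
  have hM : IsMarkovKernel (causalKernel σ ν κ₁ κ₂) := by
    unfold causalKernel; infer_instance
  have hfst : ∀ x, (causalKernel σ ν κ₁ κ₂ (q, x)).map Prod.fst =
      (Kernel.const _ ν ⊗ₖ κ₁.comap (fun p : (𝒬 × ∀ k, X k) × Y (σ 0) =>
        (p.1.2 (σ 0), p.2, p.1.1)) (by fun_prop)) (q, x) := fun x => by
    rw [causalKernel, ← Kernel.map_apply _ measurable_fst, ← Kernel.fst_eq, Kernel.fst_compProd]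
  refine ⟨fun x => Measure.isProbabilityMeasure_map hasm.aemeasurable, fun x x' => ?_,
    fun x x' h0 => ?_, fun x x' h0 h1 => ?_⟩
  · rw [Measure.map_map (by fun_prop) hasm, Measure.map_map (by fun_prop) hasm]
    simp only [Function.comp_def, assemble_zero]
    change Measure.map (Prod.fst ∘ Prod.fst) _ = Measure.map (Prod.fst ∘ Prod.fst) _
    rw [← Measure.map_map measurable_fst measurable_fst,
      ← Measure.map_map measurable_fst measurable_fst, hfst, hfst,
      ← Kernel.map_apply _ measurable_fst, ← Kernel.map_apply _ measurable_fst, ← Kernel.fst_eq,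
      Kernel.fst_compProd, Kernel.const_apply, Kernel.const_apply]
  · rw [Measure.map_map (by fun_prop) hasm, Measure.map_map (by fun_prop) hasm]
    simp only [Function.comp_def, assemble_zero, assemble_one]
    change Measure.map Prod.fst _ = Measure.map Prod.fst _
    rw [hfst, hfst, Kernel.compProd_apply_eq_compProd_sectR,
      Kernel.compProd_apply_eq_compProd_sectR]
    congr 1
    ext1 a
    simp [Kernel.sectR_apply, Kernel.comap_apply, h0]
  · congr 1
    rw [causalKernel, Kernel.compProd_apply_eq_compProd_sectR,
      Kernel.compProd_apply_eq_compProd_sectR, Kernel.compProd_apply_eq_compProd_sectR,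
      Kernel.compProd_apply_eq_compProd_sectR]
    congr 1
    · congr 1
      ext1 a
      simp [Kernel.sectR_apply, Kernel.comap_apply, h0]
    · ext1 a
      simp [Kernel.sectR_apply, Kernel.comap_apply, h0, h1]

/-- Outputs are split off one at a time by the chain rule; `e1`, `e2`, `e3` bound the increments due
to Y_a, Y_b, Y_c. -/
theorem klDiv_causalKernel_le_sumRateBound (P : InputDist X 𝒬)
    (V : Kernel (∀ k, X k) (∀ k, Y k)) [IsMarkovKernel V] (σ : Equiv.Perm (Fin 3)) :
    klDiv ((P.jointLaw V).map fun ω => ((ω.1, ω.2.1),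
        ((ω.2.2 (σ 0), ω.2.2 (σ 1)), ω.2.2 (σ 2))))
      ((P.jointLaw V).map (fun ω => (ω.1, ω.2.1)) ⊗ₘ causalKernel σ
        ((P.jointLaw V).map fun ω => ω.2.2 (σ 0))
        (condDistrib (fun ω => ω.2.2 (σ 1)) (fun ω => (ω.2.1 (σ 0), ω.2.2 (σ 0), ω.1))
          (P.jointLaw V))
        (condDistrib (fun ω => ω.2.2 (σ 2)) (fun ω => (ω.2.1 (σ 0), ω.2.2 (σ 0), ω.2.1 (σ 1),
          ω.2.2 (σ 1), ω.1)) (P.jointLaw V))) ≤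
      sumRateBound P V σ := by
  set μ := P.jointLaw V
  set ν := μ.map fun ω => ω.2.2 (σ 0) with hν
  have hνp : IsProbabilityMeasure ν := Measure.isProbabilityMeasure_map (by fun_prop)
  set κ₁ := condDistrib (fun ω => ω.2.2 (σ 1)) (fun ω => (ω.2.1 (σ 0), ω.2.2 (σ 0), ω.1)) μ
  set κ₂ := condDistrib (fun ω => ω.2.2 (σ 2)) (fun ω => (ω.2.1 (σ 0), ω.2.2 (σ 0), ω.2.1 (σ 1),
          ω.2.2 (σ 1), ω.1)) μ
  let S : 𝒬 × (∀ k, X k) × (∀ k, Y k) → 𝒬 × ∀ k, X k := fun ω => (ω.1, ω.2.1)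
  have hS : Measurable S := by fun_prop
  have hSp : IsProbabilityMeasure (μ.map S) := Measure.isProbabilityMeasure_map hS.aemeasurable
  have e1 : klDiv (μ.map fun ω => (S ω, ω.2.2 (σ 0))) (μ.map S ⊗ₘ Kernel.const _ ν) ≤
      mutualInfo μ (fun ω => ω.2.2 (σ 0)) (fun ω => (ω.2.1, ω.1)) := by
    have hφ : Measurable fun p : Y (σ 0) × (∀ k, X k) × 𝒬 => (p.2.swap, p.1) := by fun_prop
    have h := klDiv_map_le (μ.map fun ω => (ω.2.2 (σ 0), (ω.2.1, ω.1)))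
      ((μ.map fun ω => ω.2.2 (σ 0)).prod (μ.map fun ω => (ω.2.1, ω.1))) hφ
    rw [Measure.map_map hφ (by fun_prop)] at h
    refine le_of_eq_of_le ?_ h
    congr 1
    have : (fun p : Y (σ 0) × (∀ k, X k) × 𝒬 => (p.2.swap, p.1)) =
        Prod.swap ∘ Prod.map id Prod.swap := rfl
    rw [this, ← Measure.map_map (by fun_prop) (by fun_prop), ← Measure.map_prod_map _ _
      measurable_id measurable_swap, Measure.map_id, Measure.prod_swap,
      Measure.map_map measurable_swap (by fun_prop), Measure.compProd_const]
    rfl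
  have e2 := klDiv_compProd_condDistrib_le_condMutualInfo μ
    (U := fun ω => ω.2.2 (σ 1)) (V := fun ω => (ω.2.1 (σ 1), ω.2.1 (σ 2)))
    (T := fun ω => (ω.2.1 (σ 0), ω.2.2 (σ 0), ω.1)) (by fun_prop) (by fun_prop) (by fun_prop)
    (Z := fun ω => (S ω, ω.2.2 (σ 0)))
    (j := fun p => ((p.1.2.2, assemble σ (p.1.1, p.2.1, p.2.2)), p.1.2.1))
    (g := fun p => (p.1.2 (σ 0), p.2, p.1.1))
    (((measurable_fst.snd.snd).prodMk ((measurable_assemble σ).comp (by fun_prop))).prodMk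
      (by fun_prop)) (by fun_prop) (fun ω => by simp [S]) (fun p => by simp)
  have e3 := klDiv_compProd_condDistrib_le_condMutualInfo μ
    (U := fun ω => ω.2.2 (σ 2)) (V := fun ω => ω.2.1 (σ 2))
    (T := fun ω => (ω.2.1 (σ 0), ω.2.2 (σ 0), ω.2.1 (σ 1), ω.2.2 (σ 1), ω.1)) (by fun_prop)
    (by fun_prop) (by fun_prop)
    (Z := fun ω => (S ω, (ω.2.2 (σ 0), ω.2.2 (σ 1))))
    (j := fun p => ((p.1.2.2.2.2, assemble σ (p.1.1, p.1.2.2.1, p.2)), (p.1.2.1, p.1.2.2.2.1)))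
    (g := fun p => (p.1.2 (σ 0), p.2.1, p.1.2 (σ 1), p.2.2, p.1.1))
    (((measurable_fst.snd.snd.snd.snd).prodMk ((measurable_assemble σ).comp
      (by fun_prop))).prodMk (by fun_prop)) (by fun_prop) (fun ω => by simp [S])
    (fun p => by simp)
  have s1 : klDiv (μ.map fun ω => (S ω, (ω.2.2 (σ 0), ω.2.2 (σ 1))))
      (μ.map S ⊗ₘ (Kernel.const _ ν ⊗ₖ κ₁.comap (fun p => (p.1.2 (σ 0), p.2, p.1.1))
        (by fun_prop))) ≤ mutualInfo μ (fun ω => ω.2.2 (σ 0)) (fun ω => (ω.2.1, ω.1)) +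
      condMutualInfo μ (fun ω => ω.2.2 (σ 1)) (fun ω => (ω.2.1 (σ 1), ω.2.1 (σ 2)))
        (fun ω => (ω.2.1 (σ 0), ω.2.2 (σ 0), ω.1)) := by
    rw [map_prodMk_prodMk μ (by fun_prop) (by fun_prop) (by fun_prop), ← Measure.compProd_assoc', klDiv_map_measurableEquiv,
      klDiv_map_prodMk_eq_add μ (by fun_prop)]
    exact add_le_add e1 e2
  change klDiv (μ.map fun ω => (S ω, ((ω.2.2 (σ 0), ω.2.2 (σ 1)), ω.2.2 (σ 2)))) _ ≤ _
  rw [causalKernel, map_prodMk_prodMk μ (by fun_prop) (by fun_prop) (by fun_prop), ← Measure.compProd_assoc',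
    klDiv_map_measurableEquiv, klDiv_map_prodMk_eq_add μ (by fun_prop)]
  exact add_le_add s1 e3

theorem lintegral_causalDiv_le_sumRateBound (P : InputDist X 𝒬)
    (V : Kernel (∀ k, X k) (∀ k, Y k)) [IsMarkovKernel V] (σ : Equiv.Perm (Fin 3)) :
    ∫⁻ q, causalDiv V σ (fun k => P.inp k q) ∂P.lawQ ≤ sumRateBound P V σ := by
  refine le_trans ?_ (klDiv_causalKernel_le_sumRateBound P V σ)
  set μ := P.jointLaw V with hμ
  set κ₁ := condDistrib (fun ω => ω.2.2 (σ 1)) (fun ω => (ω.2.1 (σ 0), ω.2.2 (σ 0), ω.1)) μ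
  set κ₂ := condDistrib (fun ω => ω.2.2 (σ 2)) (fun ω => (ω.2.1 (σ 0), ω.2.2 (σ 0), ω.2.1 (σ 1),
          ω.2.2 (σ 1), ω.1)) μ
  set ν := μ.map fun ω => ω.2.2 (σ 0) with hν
  have hνp : IsProbabilityMeasure ν := Measure.isProbabilityMeasure_map (by fun_prop)
  have hM : IsMarkovKernel (causalKernel (X := X) σ ν κ₁ κ₂) := by
    unfold causalKernel; infer_instance
  have hasm : Measurable fun p : (Y (σ 0) × Y (σ 1)) × Y (σ 2) =>
      assemble σ (p.1.1, p.1.2, p.2) := (measurable_assemble σ).comp (by fun_prop)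
  set r := (causalKernel (X := X) σ ν κ₁ κ₂).map fun p => assemble σ (p.1.1, p.1.2, p.2) with hr
  have hrM : IsMarkovKernel r := Kernel.IsMarkovKernel.map _ hasm
  have hjoint : (μ.map fun ω => ((ω.1, ω.2.1), ω.2.2)) =
      (P.lawQ ⊗ₘ P.kernel) ⊗ₘ V.prodMkLeft 𝒬 := by
    rw [hμ, InputDist.jointLaw, ← Measure.compProd_assoc]
    rfl
  have hin : μ.map (fun ω => (ω.1, ω.2.1)) = P.lawQ ⊗ₘ P.kernel := by
    rw [← Measure.fst_compProd (P.lawQ ⊗ₘ P.kernel) (V.prodMkLeft 𝒬), ← hjoint, Measure.fst,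
      Measure.map_map (by fun_prop) (by fun_prop)]
    rfl
  have hpush := klDiv_map_le
    (μ.map fun ω => ((ω.1, ω.2.1), ((ω.2.2 (σ 0), ω.2.2 (σ 1)), ω.2.2 (σ 2))))
    (μ.map (fun ω => (ω.1, ω.2.1)) ⊗ₘ causalKernel σ ν κ₁ κ₂) (measurable_id.prodMap hasm)
  rw [Measure.map_map (measurable_id.prodMap hasm) (by fun_prop), hin,
    ← Measure.compProd_map hasm, ← hr] at hpush
  have hcomp : (Prod.map id (fun p : (Y (σ 0) × Y (σ 1)) × Y (σ 2) =>
      assemble σ (p.1.1, p.1.2, p.2)) ∘ fun ω : 𝒬 × (∀ k, X k) × (∀ k, Y k) =>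
      ((ω.1, ω.2.1), ((ω.2.2 (σ 0), ω.2.2 (σ 1)), ω.2.2 (σ 2)))) =
      fun ω => ((ω.1, ω.2.1), ω.2.2) := by
    funext ω
    simp
  rw [hcomp, hjoint] at hpush
  rw [hin]
  refine le_trans ?_ hpush
  refine le_trans ?_ (lintegral_klDiv_le_klDiv_compProd _ _ _)
  rw [Measure.lintegral_compProd (measurable_klDiv _ _)]
  refine lintegral_mono fun q => ?_
  have hq : ∀ x, r (q, x) = (causalKernel σ ν κ₁ κ₂ (q, x)).map fun p =>
      assemble σ (p.1.1, p.1.2, p.2) := fun x => Kernel.map_apply _ hasm _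
  -- For fixed `q`, the constructed kernel is a competitor in the infimum defining `causalDiv`.
  refine (iInf_le _ ⟨_, causal_causalKernel σ ν κ₁ κ₂ q⟩).trans (le_of_eq ?_)
  refine lintegral_congr fun x => ?_
  rw [hq]
  rfl

end SumRate

/-! ### Upper semicontinuity under weak limits. -/

section WeakLimit

variable {K : Type*} [TopologicalSpace K] [CompactSpace K] [SecondCountableTopology K]
  [MeasurableSpace K] [BorelSpace K]

/-- The pointwise infimum of continuous functions is upper semicontinuous, and so is its integral
as a function of the probability measure. -/
theorem le_lintegral_iInf_of_tendsto {ι : Type*} [Nonempty ι] (f : ι → C(K, ℝ≥0)) {L : Filter ℕ}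
    [L.NeBot] {μ : ℕ → ProbabilityMeasure K} {ν : ProbabilityMeasure K}
    (hμ : Tendsto μ L (𝓝 ν)) {c : ℝ≥0∞} {ε : ℕ → ℝ≥0∞} (hε : Tendsto ε L (𝓝 0))
    (h : ∀ N, c ≤ ∫⁻ q, ⨅ i, (f i q : ℝ≥0∞) ∂(μ N : Measure K) + ε N) :
    c ≤ ∫⁻ q, ⨅ i, (f i q : ℝ≥0∞) ∂(ν : Measure K) := by
  have hne : Nonempty K := (ν : Measure K).nonempty_of_neZero
  -- Second countability reduces the infimum to a countable subfamily, making monotone convergence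
  -- available.
  obtain ⟨S, hSf, hSc, hS⟩ := exists_countable_upperSemicontinuous_isGLB
    (𝓕 := Set.range fun i (q : K) => (f i q : ℝ≥0∞)) (s := ⨅ i, fun q : K => (f i q : ℝ≥0∞))
    (by
      rintro _ ⟨i, rfl⟩
      exact (ENNReal.continuous_coe.comp (f i).continuous).upperSemicontinuous) isGLB_iInf
  -- An empty subfamily would have infimum ⊤, while every `f i` is finite.
  have hSne : S.Nonempty := by
    rw [Set.nonempty_iff_ne_empty]
    rintro rfl
    have htop : (⨅ i, fun q : K => (f i q : ℝ≥0∞)) = ⊤ := by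
      simpa using hS
    obtain ⟨q⟩ := hne
    have := (iInf_le (fun i => fun q : K => (f i q : ℝ≥0∞)) (Classical.arbitrary ι)) q
    rw [htop] at this
    simp at this
  obtain ⟨t, rfl⟩ := hSc.exists_eq_range hSne
  choose g hg using fun j => hSf (Set.mem_range_self j)
  have hinf : ∀ q, ⨅ i, (f i q : ℝ≥0∞) = ⨅ j, (f (g j) q : ℝ≥0∞) := fun q => by
    have h := congrFun (hS.unique isGLB_iInf) q
    simpa only [iInf_apply, ← hg] using h
  -- Running minima form a decreasing sequence of continuous functions with the same infimum.
  let H : ℕ → C(K, ℝ≥0) := fun N => Nat.rec (f (g 0)) (fun N F => F ⊓ f (g (N + 1))) N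
  have hHanti : Antitone H := antitone_nat_of_succ_le fun N => inf_le_left
  have hHle : ∀ N, H N ≤ f (g N) := fun N => by
    cases N with
    | zero => exact le_rfl
    | succ N => exact inf_le_right
  have hHge : ∀ N q, ⨅ j, (f (g j) q : ℝ≥0∞) ≤ H N q := fun N q => by
    induction N with
    | zero => exact iInf_le _ 0
    | succ N ih =>
      change _ ≤ ((H N q ⊓ f (g (N + 1)) q : ℝ≥0) : ℝ≥0∞)
      rw [ENNReal.coe_min]
      exact le_min ih (iInf_le _ (N + 1))
  have hH : ∀ q, ⨅ i, (f i q : ℝ≥0∞) = ⨅ N, (H N q : ℝ≥0∞) := fun q => by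
    rw [hinf]
    exact le_antisymm (le_iInf fun N => hHge N q)
      (iInf_mono fun N => ENNReal.coe_le_coe.2 (hHle N q))
  have hlim : ∀ N, Tendsto (fun M => ∫⁻ q, (H N q : ℝ≥0∞) ∂(μ M : Measure K)) L
      (𝓝 (∫⁻ q, (H N q : ℝ≥0∞) ∂(ν : Measure K))) := fun N =>
    ProbabilityMeasure.tendsto_iff_forall_lintegral_tendsto.1 hμ
      (BoundedContinuousFunction.mkOfCompact (H N))
  have hfin : ∫⁻ q, (H 0 q : ℝ≥0∞) ∂(ν : Measure K) ≠ ∞ :=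
    ((BoundedContinuousFunction.mkOfCompact (H 0)).lintegral_lt_top_of_nnreal (ν : Measure K)).ne
  simp only [hH] at h ⊢
  have hHm : ∀ N, Measurable fun q => (H N q : ℝ≥0∞) := fun N =>
    (ENNReal.continuous_coe.comp (H N).continuous).measurable
  rw [lintegral_iInf hHm
    (fun M N hMN q => ENNReal.coe_le_coe.2 (hHanti hMN q)) hfin]
  refine le_iInf fun N => ?_
  have hadd := (hlim N).add hε
  rw [add_zero] at hadd
  refine ge_of_tendsto' hadd fun M => (h M).trans (add_le_add (lintegral_mono fun q => ?_) le_rfl)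
  exact iInf_le _ N

end WeakLimit

/-! ### Finite alphabets: attainment by compactness. -/

section Finite

variable {X Y : Fin 3 → Type*} [∀ k, MeasurableSpace (X k)] [∀ k, MeasurableSpace (Y k)]

omit [∀ k, MeasurableSpace (X k)] in
theorem Causal.mix {σ : Equiv.Perm (Fin 3)} {r r' : (∀ k, X k) → Measure (∀ k, Y k)}
    (hr : Causal σ r) (hr' : Causal σ r') {a b : ℝ} (ha : 0 ≤ a) (hb : 0 ≤ b) (hab : a + b = 1) :
    Causal σ fun x => ENNReal.ofReal a • r x + ENNReal.ofReal b • r' x where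
  isProb x := ⟨by
    have := hr.isProb x
    have := hr'.isProb x
    simp [← ENNReal.ofReal_add ha hb, hab]⟩
  congr₁ x x' := by
    rw [Measure.map_add _ _ (by fun_prop), Measure.map_add _ _ (by fun_prop), Measure.map_smul,
      Measure.map_smul, Measure.map_smul, Measure.map_smul, hr.congr₁ x x', hr'.congr₁ x x']
  congr₂ x x' h := by
    rw [Measure.map_add _ _ (by fun_prop), Measure.map_add _ _ (by fun_prop), Measure.map_smul,
      Measure.map_smul, Measure.map_smul, Measure.map_smul, hr.congr₂ x x' h, hr'.congr₂ x x' h]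
  congr₃ x x' h h' := by rw [hr.congr₃ x x' h h', hr'.congr₃ x x' h h']

variable [∀ k, Finite (Y k)] [∀ k, MeasurableSingletonClass (Y k)] [∀ k, Nonempty (Y k)]

/-- Over finite output alphabets, a causal channel can be perturbed to one with finite
divergences. -/
theorem Causal.exists_klDiv_ne_top (V : Kernel (∀ k, X k) (∀ k, Y k)) [IsMarkovKernel V]
    {σ : Equiv.Perm (Fin 3)} {r : (∀ k, X k) → Measure (∀ k, Y k)} (hr : Causal σ r) {ε : ℝ}
    (hε : 0 < ε) :
    ∃ r' : (∀ k, X k) → Measure (∀ k, Y k), (Causal σ r' ∧ ∀ x, klDiv (V x) (r' x) ≠ ∞) ∧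
      ∀ x, klDiv (V x) (r' x) ≤ klDiv (V x) (r x) + ENNReal.ofReal ε := by
  have := Fintype.ofFinite (∀ k, Y k)
  let u : Measure (∀ k, Y k) := (PMF.uniformOfFintype (∀ k, Y k)).toMeasure
  have hu : IsProbabilityMeasure u := PMF.toMeasure.isProbabilityMeasure _
  have hb : 0 < 1 - Real.exp (-ε) := by
    rw [sub_pos, Real.exp_lt_one_iff]
    linarith
  -- The weight exp(-ε) on `r` costs at most log exp(ε) = ε in divergence; the uniform part has full
  -- support, which makes the divergence finite.
  have hmix := hr.mix (Causal.const σ u) (Real.exp_pos (-ε)).le hb.le (by ring)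
  have hp := hmix.isProb
  have hrp := hr.isProb
  refine ⟨_, ⟨hmix, fun x => klDiv_ne_top ?_ .of_finite⟩, fun x => ?_⟩
  · refine Measure.AbsolutelyContinuous.mk fun s hs hs0 => ?_
    have hs' : s = ∅ := by
      by_contra hne
      obtain ⟨y, hy⟩ := Set.nonempty_iff_ne_empty.2 hne
      have h1 : u {y} ≠ 0 := by
        simp [u, PMF.toMeasure_apply_singleton _ _ (measurableSet_singleton _)]
      have h2 : u s ≠ 0 := fun h0 => h1 (measure_mono_null (Set.singleton_subset_iff.2 hy) h0)
      simp [h2] at hs0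
      linarith [hs0.2]
    simp [hs']
  · have h := klDiv_le_add_log_of_le_smul (V x) (r x)
      (ν' := ENNReal.ofReal (Real.exp (-ε)) • r x + ENNReal.ofReal (1 - Real.exp (-ε)) • u)
      (Real.one_le_exp hε.le) ?_
    · rwa [Real.log_exp] at h
    · rw [smul_add, smul_smul, ← ENNReal.ofReal_mul (Real.exp_pos ε).le, ← Real.exp_add,
        add_neg_cancel, Real.exp_zero, ENNReal.ofReal_one, one_smul]
      exact Measure.le_add_right le_rfl

/-- Expectations of finite functions are continuous in the input probability vectors. Restricting to
finite divergences thus makes `causalDiv` an infimum of continuous functions. -/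
theorem causalDiv_eq_iInf_ne_top (V : Kernel (∀ k, X k) (∀ k, Y k)) [IsMarkovKernel V]
    (σ : Equiv.Perm (Fin 3)) (p : ∀ k, Measure (X k)) [∀ k, IsProbabilityMeasure (p k)] :
    causalDiv V σ p = ⨅ r : {r : (∀ k, X k) → Measure (∀ k, Y k) //
      Causal σ r ∧ ∀ x, klDiv (V x) (r x) ≠ ∞}, ∫⁻ x, klDiv (V x) (r.1 x) ∂(Measure.pi p) := by
  refine le_antisymm (le_iInf fun r => iInf_le _ (⟨r.1, r.2.1⟩ :
    {r : (∀ k, X k) → Measure (∀ k, Y k) // Causal σ r})) (le_iInf fun r => ?_)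
  refine ENNReal.le_of_forall_pos_le_add fun ε hε _ => ?_
  obtain ⟨r', hr', hle⟩ := r.2.exists_klDiv_ne_top V (NNReal.coe_pos.2 hε)
  refine (iInf_le _ ⟨r', hr'⟩).trans ((lintegral_mono hle).trans ?_)
  rw [lintegral_add_right _ measurable_const]
  simp

/-- Tuples of probability vectors. -/
abbrev SimplexTuple (n : Fin 3 → ℕ) : Type := ∀ k, stdSimplex ℝ (Fin (n k))

variable {n : Fin 3 → ℕ} (e : ∀ k, Fin (n k) ≃ X k)

/-- The kernel that samples an input letter from a given probability vector. -/
noncomputable def simplexKernel (k : Fin 3) : Kernel (SimplexTuple n) (X k) where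
  toFun q := ∑ j, ENNReal.ofReal (q k j) • Measure.dirac (e k j)
  measurable' := by
    refine Measure.measurable_of_measurable_coe _ fun s hs => ?_
    simp only [Measure.coe_finsetSum, Finset.sum_apply, Measure.smul_apply, smul_eq_mul]
    refine Finset.measurable_sum _ fun j _ => Measurable.mul_const ?_ _
    exact ENNReal.measurable_ofReal.comp
      ((measurable_pi_apply j).comp (measurable_subtype_coe.comp (measurable_pi_apply k)))

instance (k : Fin 3) : IsMarkovKernel (simplexKernel e k) := ⟨fun q => ⟨by
  change (∑ j, ENNReal.ofReal (q k j) • Measure.dirac (e k j)) Set.univ = 1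
  simp only [Measure.coe_finsetSum, Finset.sum_apply, Measure.smul_apply, smul_eq_mul,
    measure_univ, mul_one]
  have h0 : ∀ j, 0 ≤ q k j := (q k).2.1
  have h1 : ∑ j, q k j = 1 := (q k).2.2
  rw [← ENNReal.ofReal_sum_of_nonneg fun j _ => h0 j, h1, ENNReal.ofReal_one]⟩⟩

theorem simplexKernel_singleton [∀ k, MeasurableSingletonClass (X k)] (k : Fin 3)
    (q : SimplexTuple n) (x : X k) :
    simplexKernel e k q {x} = ENNReal.ofReal (q k ((e k).symm x)) := by
  change (∑ j, ENNReal.ofReal (q k j) • Measure.dirac (e k j)) {x} = _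
  simp only [Measure.coe_finsetSum, Finset.sum_apply, Measure.smul_apply, smul_eq_mul]
  rw [Finset.sum_eq_single ((e k).symm x)]
  · simp
  · intro j _ hj
    have : e k j ≠ x := fun h => hj (by simp [← h])
    simp [this]
  · simp

/-- The probability vectors of a tuple of probability measures. -/
noncomputable def toSimplex [∀ k, MeasurableSingletonClass (X k)] (p : ∀ k, Measure (X k))
    [∀ k, IsProbabilityMeasure (p k)] : SimplexTuple n := fun k =>
  ⟨fun j => (p k).real {e k j}, fun _ => measureReal_nonneg, by
    have : Fintype (X k) := Fintype.ofEquiv _ (e k)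
    rw [(e k).sum_comp fun x => (p k).real {x}, sum_measureReal_singleton]
    simp⟩

theorem simplexKernel_toSimplex [∀ k, MeasurableSingletonClass (X k)] (p : ∀ k, Measure (X k))
    [∀ k, IsProbabilityMeasure (p k)] (k : Fin 3) :
    simplexKernel e k (toSimplex e p) = p k := by
  have : Finite (X k) := Finite.of_equiv _ (e k)
  refine Measure.ext_of_singleton fun x => ?_
  rw [simplexKernel_singleton]
  change ENNReal.ofReal ((p k).real {e k ((e k).symm x)}) = _
  simp

/-- The expectation of a finite function of independent inputs, as a continuous function of their
probability vectors. -/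
theorem exists_continuousMap_lintegral_simplexKernel [∀ k, MeasurableSingletonClass (X k)]
    (f : (∀ k, X k) → ℝ≥0∞) (hf : ∀ x, f x ≠ ∞) :
    ∃ g : C(SimplexTuple n, ℝ≥0), ∀ q,
      (g q : ℝ≥0∞) = ∫⁻ x, f x ∂(Measure.pi fun k => simplexKernel e k q) := by
  have : ∀ k, Finite (X k) := fun k => Finite.of_equiv _ (e k)
  have := Fintype.ofFinite (∀ k, X k)
  refine ⟨⟨fun q => ∑ x : ∀ k, X k, (f x).toNNReal * ∏ k, (q k ((e k).symm (x k))).toNNReal,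
    ?_⟩, fun q => ?_⟩
  · have hc : ∀ k j, Continuous fun q : SimplexTuple n => (q k j).toNNReal := fun k j =>
      continuous_real_toNNReal.comp
        ((continuous_apply j).comp (continuous_subtype_val.comp (continuous_apply k)))
    exact continuous_finsetSum _ fun x _ => continuous_const.mul
      (continuous_finsetProd _ fun k _ => hc k _)
  · rw [lintegral_fintype]
    simp only [ContinuousMap.coe_mk, ENNReal.ofNNReal_finsetSum, ENNReal.coe_mul,
      ENNReal.ofNNReal_finsetProd, Measure.pi_singleton, simplexKernel_singleton,
      ENNReal.coe_toNNReal (hf _)]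
    rfl

/-- The time-sharing alphabets of near-optimal distributions may grow, so each value of Q is
replaced by the tuple of its conditional input laws. All the laws of Q then live on one compact
space. -/
theorem CausalBound.exists_inputDist_of_finite [∀ k, Finite (X k)]
    [∀ k, MeasurableSingletonClass (X k)] {W : Kernel (∀ k, X k) (∀ k, Y k)} {s : ℝ}
    (h : CausalBound W s) :
    ∃ (n : Fin 3 → ℕ) (P : InputDist X (SimplexTuple n)),
      ∀ (σ : Equiv.Perm (Fin 3)) (V : Kernel (∀ k, X k) (∀ k, Y k)) [IsMarkovKernel V],
        SameMarginals W V →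
        ENNReal.ofReal s ≤ ∫⁻ q, causalDiv V σ (fun k => P.inp k q) ∂P.lawQ := by
  let n : Fin 3 → ℕ := fun k => Nat.card (X k)
  let e : ∀ k, Fin (n k) ≃ X k := fun k => (Finite.equivFin (X k)).symm
  choose m P hP using fun N : ℕ => h (1 / ((N : ℝ) + 1)) Nat.one_div_pos_of_nat
  let μ : ℕ → ProbabilityMeasure (SimplexTuple n) := fun N =>
    ⟨(P N).lawQ.map fun q => toSimplex e fun k => (P N).inp k q,
      Measure.isProbabilityMeasure_map (measurable_of_finite _).aemeasurable⟩
  -- The ultrafilter limit is fixed before σ and V, so it serves all of them simultaneously.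
  obtain ⟨ν, -, hν⟩ := isCompact_univ.ultrafilter_le_nhds (Ultrafilter.map μ (hyperfilter ℕ))
    (by simp)
  have hμ : Tendsto μ (hyperfilter ℕ) (𝓝 ν) := hν
  refine ⟨n, ⟨ν, inferInstance, simplexKernel e, inferInstance⟩, fun σ V _ hV => ?_⟩
  choose f hf using fun r : {r : (∀ k, X k) → Measure (∀ k, Y k) //
      Causal σ r ∧ ∀ x, klDiv (V x) (r x) ≠ ∞} =>
    exists_continuousMap_lintegral_simplexKernel e (fun x => klDiv (V x) (r.1 x)) r.2.2
  have hdiv : ∀ q : SimplexTuple n, causalDiv V σ (fun k => simplexKernel e k q) =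
      ⨅ r, (f r q : ℝ≥0∞) := fun q => by
    rw [causalDiv_eq_iInf_ne_top]
    simp only [hf]
  have : Nonempty {r : (∀ k, X k) → Measure (∀ k, Y k) //
      Causal σ r ∧ ∀ x, klDiv (V x) (r x) ≠ ∞} := by
    obtain ⟨r', hr', -⟩ := (Causal.const (X := X) σ
      (Measure.dirac (Classical.arbitrary (∀ k, Y k)))).exists_klDiv_ne_top V one_pos
    exact ⟨⟨r', hr'⟩⟩
  have hε : Tendsto (fun N : ℕ => ENNReal.ofReal (1 / ((N : ℝ) + 1))) (hyperfilter ℕ) (𝓝 0) := by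
    have := (ENNReal.tendsto_ofReal tendsto_one_div_add_atTop_nhds_zero_nat).mono_left
      Nat.hyperfilter_le_atTop
    simpa using this
  change _ ≤ ∫⁻ q, causalDiv V σ (fun k => simplexKernel e k q) ∂(ν : Measure (SimplexTuple n))
  simp only [hdiv]
  refine le_lintegral_iInf_of_tendsto f hμ hε fun N => ?_
  refine (hP N σ V hV).trans (le_of_eq ?_)
  congr 1
  change _ = ∫⁻ q, _ ∂((P N).lawQ.map fun q => toSimplex e fun k => (P N).inp k q)
  rw [lintegral_map_of_finite, lintegral_fintype]
  simp only [← hdiv, simplexKernel_toSimplex]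

end Finite

end IFC

theorem theorem1 {X Y : Fin 3 → Type*}
    [∀ k, MeasurableSpace (X k)] [∀ k, StandardBorelSpace (X k)] [∀ k, Nonempty (X k)]
    [∀ k, MeasurableSpace (Y k)] [∀ k, StandardBorelSpace (Y k)] [∀ k, Nonempty (Y k)]
    (W : Kernel (∀ k, X k) (∀ k, Y k)) [IsMarkovKernel W]
    (R : Fin 3 → ℝ) (hR : R ∈ IFC.capacityRegion W) :
    (∀ ε : ℝ, 0 < ε → ∃ (m : ℕ) (P : IFC.InputDist X (Fin m)),
      ∀ (σ : Equiv.Perm (Fin 3)) (V : Kernel (∀ k, X k) (∀ k, Y k)) [IsMarkovKernel V],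
        IFC.SameMarginals W V →
        ENNReal.ofReal (R 0 + R 1 + R 2) ≤ IFC.sumRateBound P V σ + ENNReal.ofReal ε) ∧
    ((∀ k, Finite (X k)) → (∀ k, Finite (Y k)) →
      ∃ (𝒬 : Type) (_ : MeasurableSpace 𝒬) (_ : StandardBorelSpace 𝒬) (P : IFC.InputDist X 𝒬),
        ∀ (σ : Equiv.Perm (Fin 3)) (V : Kernel (∀ k, X k) (∀ k, Y k)) [IsMarkovKernel V],
          IFC.SameMarginals W V →
          ENNReal.ofReal (R 0 + R 1 + R 2) ≤ IFC.sumRateBound P V σ) := by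
  have h := IFC.causalBound_of_mem_capacityRegion hR
  refine ⟨fun ε hε => ?_, fun hX hY => ?_⟩
  · obtain ⟨m, P, hP⟩ := h ε hε
    exact ⟨m, P, fun σ V _ hV => (hP σ V hV).trans
      (add_le_add (IFC.lintegral_causalDiv_le_sumRateBound P V σ) le_rfl)⟩
  · obtain ⟨n, P, hP⟩ := h.exists_inputDist_of_finite
    have : ∀ k, StandardBorelSpace (stdSimplex ℝ (Fin (n k))) := fun k =>
      (isClosed_stdSimplex ℝ _).measurableSet.standardBorel
    exact ⟨IFC.SimplexTuple n, inferInstance, inferInstance, P, fun σ V _ hV =>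
      (hP σ V hV).trans (IFC.lintegral_causalDiv_le_sumRateBound P V σ)⟩
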